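/- Let $U$ be a Hopf algebra over $\mathbb{C}$ with bijective antipode $S$, and let $\mathcal{C}$ be a tensor category of finite-dimensional left $U$-modules (a full subcategory containing the trivial module and closed under isomorphism, tensor products and left and right duals). Let $A=U^0_{\mathcal{C}}$ be the Hopf algebra of functionals on $U$ generated by the matrix coefficients of the modules in $\mathcal{C}$, and assume that $A$ separates the elements of $U$. Let $K\subset U$ be a left coideal subalgebra, i.e. a unital subalgebra with $\Delta(K)\subset U\otimes K$, and assume that $K$ is $\mathcal{C}$-semisimple: the restriction to $K$ of every module in $\mathcal{C}$ is a direct sum of irreducible $K$-modules. Let $$B=\{b\in A \mid \langle k,b_{(1)}\rangle b_{(2)}=0\ \text{ for all } k\in K^+\},\qquad K^+=\{k-\varepsilon(k)\mid k\in K\},$$ a right coideal subalgebra of $A$, and put $B^+=\{b\in B\mid \varepsilon(b)=0\}$. Let $B^\circ$ be the dual coalgebra of $B$ (the functionals on $B$ vanishing on a two-sided ideal of finite codimension), and for a functional $f$ on $B$ and $k\in K$ let $(fk)(b)=f(b_{(1)})\langle k,b_{(2)}\rangle$. A first order differential calculus (FODC) over $B$ is a $B$-bimodule $\Gamma$ with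 a linear map $\mathrm{d}:B\to\Gamma$ such that $\mathrm{d}(ab)=a\,\mathrm{d}b+\mathrm{d}a\,b$ and $\Gamma$ is the linear span of the elements $a\,\mathrm{d}b\,c$ with $a,b,c\in B$. It is called covariant if there is a right coaction $\Phi:\Gamma\to\Gamma\otimes A$ with $\Phi(b\omega)=\Delta(b)\Phi(\omega)$, $\Phi(\omega b)=\Phi(\omega)\Delta(b)$ and $\Phi(\mathrm{d}b)=(\mathrm{d}\otimes\mathrm{id})\Delta(b)$ for all $b\in B$, $\omega\in\Gamma$. Its dimension is $\dim_{\mathbb{C}}\Gamma/\Gamma B^+$. For a FODC $\Gamma$ put $$L_\Gamma=\Big\{\sum_i (a_i-\varepsilon(a_i))\,\varepsilon(b_i)\ \Big|\ \sum_i \mathrm{d}a_i\,b_i=0\Big\}\subset B^+,\qquad T^\varepsilon_\Gamma=\{f: B\to\mathbb{C}\ \text{linear}\mid f|_{L_\Gamma}=0\}.$$ Then, for every integer $n\ge 0$, the map $\Gamma\mapsto T^\varepsilon_\Gamma$ is a well-defined one-to-one correspondence between the isomorphism classes of $n$-dimensional covariant FODC over $B$ and the $(n+1)$-dimensional subspaces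 $T^\varepsilon\subset B^\circ$ such that $$\varepsilon\in T^\varepsilon,\qquad \Delta T^\varepsilon\subset B^\circ\otimes T^\varepsilon,\qquad T^\varepsilon K\subset T^\varepsilon.$$ -/

import Mathlib

open scoped TensorProduct
open Module Coalgebra WithConv

universe u

noncomputable section

namespace QTangent

/-! ### Tensors as functionals -/

section Tensors

variable {X Y V W : Type*} [AddCommGroup X] [Module ℂ X] [AddCommGroup Y] [Module ℂ Y]
  [AddCommGroup V] [Module ℂ V] [AddCommGroup W] [Module ℂ W]

/-- The functional on `V ⊗ W` defined by an element of `X ⊗ Y`, where `X` and `Y` are spaces of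
functionals on `V` and `W`: `x ⊗ y` acts as `v ⊗ w ↦ x(v) y(w)`. -/
def evTensor (i : X →ₗ[ℂ] Dual ℂ V) (j : Y →ₗ[ℂ] Dual ℂ W) : X ⊗[ℂ] Y →ₗ[ℂ] Dual ℂ (V ⊗[ℂ] W) :=
  TensorProduct.dualDistrib ℂ V W ∘ₗ TensorProduct.map i j

@[simp] lemma evTensor_tmul (i : X →ₗ[ℂ] Dual ℂ V) (j : Y →ₗ[ℂ] Dual ℂ W) (x : X) (y : Y) (v : V)
    (w : W) : evTensor i j (x ⊗ₜ y) (v ⊗ₜ w) = i x v * j y w := rfl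

lemma evTensor_injective {i : X →ₗ[ℂ] Dual ℂ V} {j : Y →ₗ[ℂ] Dual ℂ W}
    (hi : Function.Injective i) (hj : Function.Injective j) :
    Function.Injective (evTensor i j) := by
  rw [injective_iff_map_eq_zero]
  intro t ht
  obtain ⟨c, rfl⟩ := TensorProduct.eq_repr_basis_right (Basis.ofVectorSpace ℂ Y) t
  suffices h : c = 0 by simp [h]
  have key : ∀ v, (c.sum fun k x => (i x v) • (Basis.ofVectorSpace ℂ Y) k) = 0 := by
    intro v
    apply hj
    ext w
    have := LinearMap.congr_fun ht (v ⊗ₜ w)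
    simpa [Finsupp.sum, LinearMap.sum_apply] using this
  ext k
  apply hi
  ext v
  have hli := (Basis.ofVectorSpace ℂ Y).linearIndependent
  rw [linearIndependent_iff'] at hli
  by_cases hk : k ∈ c.support
  · simpa using hli c.support (fun k => i (c k) v) (key v) k hk
  · simp [Finsupp.notMem_support_iff.mp hk]

/-- A functional on `V ⊗ W` of finite rank whose slices lie in `X` and `Y` comes from `X ⊗ Y`. -/
lemma mem_range_evTensor {i : X →ₗ[ℂ] Dual ℂ V} {j : Y →ₗ[ℂ] Dual ℂ W}
    (F : Dual ℂ (V ⊗[ℂ] W))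
    (hfin : FiniteDimensional ℂ (LinearMap.range (TensorProduct.curry F)))
    (h1 : ∀ w, (TensorProduct.curry F).flip w ∈ LinearMap.range i)
    (h2 : ∀ v, TensorProduct.curry F v ∈ LinearMap.range j) :
    F ∈ LinearMap.range (evTensor i j) := by
  set L : V →ₗ[ℂ] Dual ℂ W := TensorProduct.curry F with hL
  let R := LinearMap.range L
  let b := Module.finBasis ℂ R
  let E : R →ₗ[ℂ] W →ₗ[ℂ] ℂ := R.subtype
  have hE : Function.Surjective E.flip :=
    LinearMap.flip_surjective_iff₁.mpr R.subtype_injective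
  have hx : ∀ k, b.coord k ∘ₗ L.rangeRestrict ∈ LinearMap.range i := by
    intro k
    obtain ⟨w, hw⟩ := hE (b.coord k)
    convert h1 w using 1
    ext v
    have := LinearMap.congr_fun hw (L.rangeRestrict v)
    simpa [E] using this.symm
  have hy : ∀ k, (b k : Dual ℂ W) ∈ LinearMap.range j := by
    intro k
    obtain ⟨v, hv⟩ := (b k).2
    rw [← hv]
    exact h2 v
  choose x hx using hx
  choose y hy using hy
  refine ⟨∑ k, x k ⊗ₜ y k, ?_⟩
  ext v w
  have h := congrArg (fun r : R => (r : Dual ℂ W) w) (b.sum_repr (L.rangeRestrict v))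
  simp only [Submodule.coe_sum, Submodule.coe_smul, LinearMap.sum_apply, LinearMap.smul_apply,
    LinearMap.codRestrict_apply, LinearMap.rangeRestrict, smul_eq_mul] at h
  simp only [map_sum, TensorProduct.AlgebraTensorModule.curry_apply, LinearMap.restrictScalars_self,
    TensorProduct.curry_apply, LinearMap.sum_apply, evTensor_tmul, hx, hy]
  exact h

lemma finite_range_of_mem_range_evTensor {i : X →ₗ[ℂ] Dual ℂ V} {j : Y →ₗ[ℂ] Dual ℂ W}
    {F : Dual ℂ (V ⊗[ℂ] W)} (hF : F ∈ LinearMap.range (evTensor i j)) :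
    FiniteDimensional ℂ (LinearMap.range (TensorProduct.curry F)) := by
  obtain ⟨t, rfl⟩ := hF
  obtain ⟨S, rfl⟩ := TensorProduct.exists_finset t
  have : FiniteDimensional ℂ (Submodule.span ℂ ((fun p : X × Y => j p.2) '' (S : Set (X × Y)))) :=
    FiniteDimensional.span_of_finite ℂ (S.finite_toSet.image _)
  refine Submodule.finiteDimensional_of_le (S₂ := Submodule.span ℂ
    ((fun p : X × Y => j p.2) '' (S : Set (X × Y)))) ?_
  rintro _ ⟨v, rfl⟩
  have : TensorProduct.curry ((evTensor i j) (∑ p ∈ S, p.1 ⊗ₜ[ℂ] p.2)) v =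
      ∑ p ∈ S, i p.1 v • j p.2 := by
    ext w
    simp [LinearMap.sum_apply]
  rw [this]
  exact Submodule.sum_mem _ fun p hp =>
    Submodule.smul_mem _ _ (Submodule.subset_span ⟨p, hp, rfl⟩)

variable {Z : Type*} [AddCommGroup Z] [Module ℂ Z]

/-- Factor a linear map through an injective one whose range contains all its values. -/
def liftThrough (j : Y →ₗ[ℂ] Z) (hj : Function.Injective j) (φ : X →ₗ[ℂ] Z)
    (h : ∀ x, φ x ∈ LinearMap.range j) : X →ₗ[ℂ] Y :=
  (LinearEquiv.ofInjective j hj).symm.toLinearMap ∘ₗ φ.codRestrict (LinearMap.range j) h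

@[simp] lemma apply_liftThrough (j : Y →ₗ[ℂ] Z) (hj : Function.Injective j) (φ : X →ₗ[ℂ] Z)
    (h : ∀ x, φ x ∈ LinearMap.range j) (x : X) : j (liftThrough j hj φ h x) = φ x := by
  have := (LinearEquiv.ofInjective j hj).apply_symm_apply ⟨φ x, h x⟩
  exact congrArg Subtype.val this

end Tensors

/-! ### The dual coalgebra of an algebra -/

section FinDual

variable (R : Type*) [Ring R] [Algebra ℂ R]

/-- The dual coalgebra `R°`: the functionals vanishing on a two-sided ideal of finite
codimension. -/
def finDual : Submodule ℂ (Dual ℂ R) where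
  carrier := {f | ∃ I : Submodule ℂ R, (∀ a, ∀ x ∈ I, a * x ∈ I ∧ x * a ∈ I) ∧
    FiniteDimensional ℂ (R ⧸ I) ∧ ∀ x ∈ I, f x = 0}
  zero_mem' := ⟨⊤, by simp, inferInstance, by simp⟩
  add_mem' := by
    rintro f g ⟨I, hI, hfI, hf⟩ ⟨J, hJ, hfJ, hg⟩
    refine ⟨I ⊓ J, fun a x hx => ⟨⟨(hI a x hx.1).1, (hJ a x hx.2).1⟩,
      ⟨(hI a x hx.1).2, (hJ a x hx.2).2⟩⟩, ?_, fun x hx => by simp [hf x hx.1, hg x hx.2]⟩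
    have : I ⊓ J = LinearMap.ker (I.mkQ.prod J.mkQ) := by simp [LinearMap.ker_prod]
    rw [this]
    exact (I.mkQ.prod J.mkQ).quotKerEquivRange.symm.finiteDimensional
  smul_mem' := by
    rintro c f ⟨I, hI, hfI, hf⟩
    exact ⟨I, hI, hfI, fun x hx => by simp [hf x hx]⟩

variable {R}

lemma finDual_comul_mem (f : finDual R) :
    ((LinearMap.mul' ℂ R).dualMap ∘ₗ (finDual R).subtype) f ∈
      LinearMap.range (evTensor (finDual R).subtype (finDual R).subtype) := by
  obtain ⟨f, I, hI, hfI, hf⟩ := f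
  apply mem_range_evTensor
  · have hle : I ≤ LinearMap.ker (TensorProduct.curry (f ∘ₗ LinearMap.mul' ℂ R)) := by
      intro x hx
      ext y
      simpa using hf _ (hI y x hx).2
    change FiniteDimensional ℂ (LinearMap.range (TensorProduct.curry (f ∘ₗ LinearMap.mul' ℂ R)))
    rw [← Submodule.range_liftQ I _ hle]
    infer_instance
  · intro w
    refine ⟨⟨_, I, hI, hfI, fun x hx => ?_⟩, rfl⟩
    simpa using hf _ (hI w x hx).2
  · intro w
    refine ⟨⟨_, I, hI, hfI, fun x hx => ?_⟩, rfl⟩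
    simpa using hf _ (hI w x hx).1

/-- The comultiplication of `R°`, characterised by `f₍₁₎(a) f₍₂₎(b) = f(ab)`. -/
def finDualComul : finDual R →ₗ[ℂ] finDual R ⊗[ℂ] finDual R :=
  liftThrough (evTensor (finDual R).subtype (finDual R).subtype)
    (evTensor_injective (finDual R).subtype_injective (finDual R).subtype_injective)
    ((LinearMap.mul' ℂ R).dualMap ∘ₗ (finDual R).subtype) finDual_comul_mem

lemma finDualComul_apply (f : finDual R) (a b : R) :
    evTensor (finDual R).subtype (finDual R).subtype (finDualComul f) (a ⊗ₜ b) = f.1 (a * b) := by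
  have h := apply_liftThrough (evTensor (finDual R).subtype (finDual R).subtype)
    (evTensor_injective (finDual R).subtype_injective (finDual R).subtype_injective)
    ((LinearMap.mul' ℂ R).dualMap ∘ₗ (finDual R).subtype) finDual_comul_mem f
  exact (LinearMap.congr_fun h (a ⊗ₜ b)).trans (by simp)

/-- A character of `R` as an element of `R°`. -/
def finDualOfChar (χ : R →ₐ[ℂ] ℂ) : finDual R :=
  ⟨χ.toLinearMap, LinearMap.ker χ.toLinearMap,
    fun a x hx => by
      have hx' : χ x = 0 := hx
      constructor <;> simp [hx'],
    χ.toLinearMap.quotKerEquivRange.symm.finiteDimensional, fun _ hx => hx⟩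

end FinDual

/-! ### Finite dimensional modules and tensor categories -/

section Reps

variable (U : Type u) [Ring U] [HopfAlgebra ℂ U]

/-- A finite dimensional left `U`-module. Up to isomorphism the carrier may be taken in `Type`. -/
structure FinRep where
  V : Type
  [addCommGroup : AddCommGroup V]
  [module : Module ℂ V]
  [finite : FiniteDimensional ℂ V]
  ρ : U →ₐ[ℂ] Module.End ℂ V

attribute [instance] FinRep.addCommGroup FinRep.module FinRep.finite

namespace FinRep

variable {U}

/-- Isomorphism of `U`-modules. -/
def Iso (M N : FinRep U) : Prop :=
  ∃ φ : M.V ≃ₗ[ℂ] N.V, ∀ u x, φ (M.ρ u x) = N.ρ u (φ x)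

variable (U) in
/-- The trivial module, on which `U` acts through the counit. -/
def trivial : FinRep U where
  V := ℂ
  ρ := (Algebra.ofId ℂ (Module.End ℂ ℂ)).comp (Bialgebra.counitAlgHom ℂ U)

/-- The tensor product: `u (x ⊗ y) = u₍₁₎ x ⊗ u₍₂₎ y`. -/
def tensor (M N : FinRep U) : FinRep U where
  V := M.V ⊗[ℂ] N.V
  ρ := (Module.endTensorEndAlgHom (R := ℂ) (S := ℂ) (A := ℂ)).comp
    ((Algebra.TensorProduct.map M.ρ N.ρ).comp (Bialgebra.comulAlgHom ℂ U))

/-- The left dual: `(u ξ)(x) = ξ(S(u) x)`. -/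
def leftDual (M : FinRep U) : FinRep U where
  V := Dual ℂ M.V
  ρ := AlgHom.ofLinearMap
    (Dual.transpose (R := ℂ) ∘ₗ M.ρ.toLinearMap ∘ₗ HopfAlgebra.antipode ℂ)
    (by ext; simp [Dual.transpose_apply])
    (fun a b => by
      ext; simp [Dual.transpose_apply, HopfAlgebra.antipode_mul_antidistrib])

/-- The inverse of a bijective antipode. -/
def antipodeInv (hS : Function.Bijective (HopfAlgebra.antipode ℂ (A := U))) : U →ₗ[ℂ] U :=
  (LinearEquiv.ofBijective (HopfAlgebra.antipode ℂ (A := U)) hS).symm.toLinearMap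

/-- The right dual: `(u ξ)(x) = ξ(S⁻¹(u) x)`. -/
def rightDual (hS : Function.Bijective (HopfAlgebra.antipode ℂ (A := U))) (M : FinRep U) :
    FinRep U where
  V := Dual ℂ M.V
  ρ := AlgHom.ofLinearMap
    (Dual.transpose (R := ℂ) ∘ₗ M.ρ.toLinearMap ∘ₗ antipodeInv hS)
    (by
      have h : antipodeInv hS 1 = 1 := by
        apply hS.1
        rw [HopfAlgebra.antipode_one]
        exact (LinearEquiv.ofBijective (HopfAlgebra.antipode ℂ (A := U)) hS).apply_symm_apply 1
      ext; simp [Dual.transpose_apply, h])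
    (fun a b => by
      have h : antipodeInv hS (a * b) = antipodeInv hS b * antipodeInv hS a := by
        have key := (LinearEquiv.ofBijective (HopfAlgebra.antipode ℂ (A := U)) hS).apply_symm_apply
        apply hS.1
        rw [HopfAlgebra.antipode_mul_antidistrib]
        refine (key _).trans ?_
        exact congrArg₂ (· * ·) (key a).symm (key b).symm
      ext; simp [Dual.transpose_apply, h])

end FinRep

/-- A tensor category of finite dimensional left `U`-modules, given by its class of objects: a
class of modules closed under isomorphism which contains the trivial module and is closed under
tensor products and under left and right duals. -/
structure IsTensorCategory (hS : Function.Bijective (HopfAlgebra.antipode ℂ (A := U)))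
    (C : FinRep U → Prop) : Prop where
  iso : ∀ M N, FinRep.Iso M N → C M → C N
  trivial : C (FinRep.trivial U)
  tensor : ∀ M N, C M → C N → C (M.tensor N)
  leftDual : ∀ M, C M → C M.leftDual
  rightDual : ∀ M, C M → C (M.rightDual hS)

variable {U}

/-- The matrix coefficient `u ↦ ξ(u x)`. -/
def matrixCoeff (M : FinRep U) (ξ : Dual ℂ M.V) (x : M.V) : WithConv (U →ₗ[ℂ] ℂ) :=
  toConv (ξ ∘ₗ LinearMap.applyₗ x ∘ₗ M.ρ.toLinearMap)

/-- The algebra `U⁰_C` generated by the matrix coefficients of the modules in `C`, inside the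
algebra of all functionals on `U` with the convolution product `(ab)(u) = a(u₍₁₎) b(u₍₂₎)`. -/
def coeffSubalgebra (C : FinRep U → Prop) : Subalgebra ℂ (WithConv (U →ₗ[ℂ] ℂ)) :=
  Algebra.adjoin ℂ {a | ∃ M, C M ∧ ∃ ξ x, a = matrixCoeff M ξ x}

/-- The algebra `U⁰_C` as a type. -/
def coeffAlg (C : FinRep U → Prop) : Type u := coeffSubalgebra C

variable {C : FinRep U → Prop}

instance : Ring (coeffAlg C) := inferInstanceAs (Ring (coeffSubalgebra C))

instance : Algebra ℂ (coeffAlg C) := inferInstanceAs (Algebra ℂ (coeffSubalgebra C))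

/-- Elements of `U⁰_C` as functionals on `U`. -/
def toDual (C : FinRep U → Prop) : coeffAlg C →ₗ[ℂ] Dual ℂ U :=
  (WithConv.linearEquiv ℂ (U →ₗ[ℂ] ℂ)).toLinearMap ∘ₗ (coeffSubalgebra C).val.toLinearMap

lemma toDual_injective : Function.Injective (toDual C) :=
  (WithConv.linearEquiv ℂ (U →ₗ[ℂ] ℂ)).injective.comp Subtype.val_injective

lemma toDual_mul (a b : coeffAlg C) (u : U) :
    toDual C (a * b) u = TensorProduct.dualDistrib ℂ U U (toDual C a ⊗ₜ toDual C b) (comul u) := by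
  change LinearMap.mul' ℂ ℂ (TensorProduct.map a.1.ofConv b.1.ofConv (comul u)) = _
  generalize (comul u : U ⊗[ℂ] U) = t
  induction t with
  | zero => simp
  | tmul x y => rfl
  | add x y hx hy => simp only [map_add, hx, hy]

lemma toDual_one (u : U) : toDual C 1 u = counit (R := ℂ) u := rfl

/-- The evaluation of an element of `A ⊗ A` at a pair of elements of `U`, `A = U⁰_C`. -/
abbrev ev₂ (C : FinRep U → Prop) : coeffAlg C ⊗[ℂ] coeffAlg C →ₗ[ℂ] Dual ℂ (U ⊗[ℂ] U) :=
  evTensor (toDual C) (toDual C)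

lemma ev₂_mul (s t : coeffAlg C ⊗[ℂ] coeffAlg C) (u v : U) :
    ev₂ C (s * t) (u ⊗ₜ v) = TensorProduct.dualDistrib ℂ (U ⊗[ℂ] U) (U ⊗[ℂ] U)
      (ev₂ C s ⊗ₜ ev₂ C t) (TensorProduct.tensorTensorTensorComm ℂ U U U U
        (comul (R := ℂ) u ⊗ₜ comul (R := ℂ) v)) := by
  induction s with
  | zero => simp
  | add x y hx hy => simp only [add_mul, map_add, LinearMap.add_apply, hx, hy,
      TensorProduct.add_tmul]
  | tmul a b =>
    induction t with
    | zero => simp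
    | add x y hx hy => simp only [mul_add, map_add, LinearMap.add_apply, hx, hy,
        TensorProduct.tmul_add]
    | tmul c d =>
      rw [Algebra.TensorProduct.tmul_mul_tmul, evTensor_tmul, toDual_mul, toDual_mul]
      generalize (comul u : U ⊗[ℂ] U) = p
      generalize (comul v : U ⊗[ℂ] U) = q
      induction p with
      | zero => simp
      | add x y hx hy => simp only [map_add, add_mul, hx, hy, TensorProduct.add_tmul]
      | tmul u₁ u₂ =>
        induction q with
        | zero => simp
        | add x y hx hy => simp only [map_add, mul_add, hx, hy, TensorProduct.tmul_add]
        | tmul v₁ v₂ =>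
          simp only [TensorProduct.tensorTensorTensorComm_tmul, TensorProduct.dualDistrib_apply,
            evTensor_tmul]
          ring

/-- A matrix coefficient of a module in `C` as an element of `U⁰_C`. -/
def coeff (M : FinRep U) (hM : C M) (ξ : Dual ℂ M.V) (x : M.V) : coeffAlg C :=
  (⟨matrixCoeff M ξ x, Algebra.subset_adjoin ⟨M, hM, ξ, x, rfl⟩⟩ : coeffSubalgebra C)

lemma toDual_coeff (M : FinRep U) (hM : C M) (ξ : Dual ℂ M.V) (x : M.V) (u : U) :
    toDual C (coeff M hM ξ x) u = ξ (M.ρ u x) := rfl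

lemma coeffAlg_induction {P : coeffAlg C → Prop} (h₁ : ∀ M hM ξ x, P (coeff M hM ξ x))
    (h₂ : ∀ r : ℂ, P (algebraMap ℂ (coeffAlg C) r)) (h₃ : ∀ a b, P a → P b → P (a + b))
    (h₄ : ∀ a b, P a → P b → P (a * b)) (a : coeffAlg C) : P a := by
  let Q : coeffSubalgebra C → Prop := P
  have h₂' : ∀ r : ℂ, Q (algebraMap ℂ (coeffSubalgebra C) r) := h₂
  have h₃' : ∀ a b : coeffSubalgebra C, Q a → Q b → Q (a + b) := h₃
  have h₄' : ∀ a b : coeffSubalgebra C, Q a → Q b → Q (a * b) := h₄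
  have h₁' : ∀ M hM ξ x, Q (coeff M hM ξ x) := h₁
  suffices h : ∀ x (hx : x ∈ coeffSubalgebra C), Q ⟨x, hx⟩ from h a.1 a.2
  clear_value Q
  clear h₁ h₂ h₃ h₄ a
  intro x hx
  induction hx using Algebra.adjoin_induction with
  | mem x hx =>
    obtain ⟨M, hM, ξ, y, rfl⟩ := hx
    exact h₁' M hM ξ y
  | algebraMap r => exact h₂' r
  | add x y hx hy ihx ihy => exact h₃' ⟨x, hx⟩ ⟨y, hy⟩ ihx ihy
  | mul x y hx hy ihx ihy => exact h₄' ⟨x, hx⟩ ⟨y, hy⟩ ihx ihy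

lemma exists_comul (a : coeffAlg C) :
    ∃ t, ∀ u v, ev₂ C t (u ⊗ₜ v) = toDual C a (u * v) := by
  induction a using coeffAlg_induction with
  | h₁ M hM ξ x =>
    let b := Module.finBasis ℂ M.V
    refine ⟨∑ k, coeff M hM ξ (b k) ⊗ₜ coeff M hM (b.coord k) x, fun u v => ?_⟩
    have h := congrArg (fun y => ξ (M.ρ u y)) (b.sum_repr (M.ρ v x))
    simp only [map_sum, map_smul, smul_eq_mul] at h
    simp only [map_sum, LinearMap.sum_apply, evTensor_tmul, toDual_coeff, map_mul,
      Module.End.mul_apply]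
    rw [← h]
    exact Finset.sum_congr rfl fun k _ => mul_comm _ _
  | h₂ r =>
    refine ⟨r • (1 ⊗ₜ 1), fun u v => ?_⟩
    simp only [Algebra.algebraMap_eq_smul_one, map_smul, LinearMap.smul_apply, evTensor_tmul,
      toDual_one, Bialgebra.counit_mul]
  | h₃ a b iha ihb =>
    obtain ⟨s, hs⟩ := iha
    obtain ⟨t, ht⟩ := ihb
    exact ⟨s + t, fun u v => by simp only [map_add, LinearMap.add_apply, hs, ht]⟩
  | h₄ a b iha ihb =>
    obtain ⟨s, hs⟩ := iha
    obtain ⟨t, ht⟩ := ihb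
    refine ⟨s * t, fun u v => ?_⟩
    rw [ev₂_mul, toDual_mul, Bialgebra.comul_mul]
    generalize (comul u : U ⊗[ℂ] U) = p
    generalize (comul v : U ⊗[ℂ] U) = q
    induction p with
    | zero => simp
    | add x y hx hy => simp only [map_add, add_mul, hx, hy, TensorProduct.add_tmul]
    | tmul u₁ u₂ =>
      induction q with
      | zero => simp
      | add x y hx hy => simp only [map_add, mul_add, hx, hy, TensorProduct.tmul_add]
      | tmul v₁ v₂ =>
        simp only [TensorProduct.tensorTensorTensorComm_tmul, TensorProduct.dualDistrib_apply,
          Algebra.TensorProduct.tmul_mul_tmul, hs, ht]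

lemma coeffAlg_comul_mem (a : coeffAlg C) :
    ((LinearMap.mul' ℂ U).dualMap ∘ₗ toDual C) a ∈ LinearMap.range (ev₂ C) := by
  obtain ⟨t, ht⟩ := exists_comul a
  refine ⟨t, ?_⟩
  ext u v
  exact (ht u v).trans (by simp)

lemma ev₂_injective : Function.Injective (ev₂ C) :=
  evTensor_injective toDual_injective toDual_injective

/-- The comultiplication of `A = U⁰_C`, characterised by `a₍₁₎(u) a₍₂₎(v) = a(uv)`. -/
def coeffComul (C : FinRep U → Prop) : coeffAlg C →ₗ[ℂ] coeffAlg C ⊗[ℂ] coeffAlg C :=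
  liftThrough (ev₂ C) ev₂_injective ((LinearMap.mul' ℂ U).dualMap ∘ₗ toDual C) coeffAlg_comul_mem

lemma ev₂_coeffComul (a : coeffAlg C) (u v : U) :
    ev₂ C (coeffComul C a) (u ⊗ₜ v) = toDual C a (u * v) := by
  rw [coeffComul, apply_liftThrough]
  simp

/-- Evaluation of elements of `A = U⁰_C` at `u ∈ U`, i.e. the pairing `⟨u, a⟩`. -/
def pairing (C : FinRep U → Prop) (u : U) : coeffAlg C →ₗ[ℂ] ℂ :=
  LinearMap.applyₗ u ∘ₗ toDual C

lemma toDual_lid_pairing (t : coeffAlg C ⊗[ℂ] coeffAlg C) (u v : U) :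
    toDual C (TensorProduct.lid ℂ _ ((pairing C u).rTensor (coeffAlg C) t)) v =
      ev₂ C t (u ⊗ₜ v) := by
  induction t with
  | zero => simp
  | add x y hx hy => simp only [map_add, LinearMap.add_apply, hx, hy]
  | tmul a b => simp [pairing]

lemma toDual_rid_pairing (t : coeffAlg C ⊗[ℂ] coeffAlg C) (u v : U) :
    toDual C (TensorProduct.rid ℂ _ ((pairing C v).lTensor (coeffAlg C) t)) u =
      ev₂ C t (u ⊗ₜ v) := by
  induction t with
  | zero => simp
  | add x y hx hy => simp only [map_add, LinearMap.add_apply, hx, hy]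
  | tmul a b => simp [pairing, mul_comm]

lemma ev₃_rTensor (t : coeffAlg C ⊗[ℂ] coeffAlg C) (u v w : U) :
    evTensor (toDual C) (ev₂ C) (TensorProduct.assoc ℂ _ _ _ ((coeffComul C).rTensor _ t))
      (u ⊗ₜ (v ⊗ₜ w)) = ev₂ C t ((u * v) ⊗ₜ w) := by
  induction t with
  | zero => simp
  | add x y hx hy => simp only [map_add, LinearMap.add_apply, hx, hy]
  | tmul a b =>
    rw [LinearMap.rTensor_tmul, evTensor_tmul, ← ev₂_coeffComul]
    generalize coeffComul C a = s
    induction s with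
    | zero => simp
    | add x y hx hy => simp only [map_add, LinearMap.add_apply, hx, hy, TensorProduct.add_tmul,
        add_mul]
    | tmul c d => simp [mul_assoc]

lemma ev₃_lTensor (t : coeffAlg C ⊗[ℂ] coeffAlg C) (u v w : U) :
    evTensor (toDual C) (ev₂ C) ((coeffComul C).lTensor _ t) (u ⊗ₜ (v ⊗ₜ w)) =
      ev₂ C t (u ⊗ₜ (v * w)) := by
  induction t with
  | zero => simp
  | add x y hx hy => simp only [map_add, LinearMap.add_apply, hx, hy]
  | tmul a b => rw [LinearMap.lTensor_tmul, evTensor_tmul, ev₂_coeffComul, evTensor_tmul]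

/-- The coalgebra structure of `A = U⁰_C`; the counit is evaluation at `1 ∈ U`. -/
instance coeffCoalgebra : Coalgebra ℂ (coeffAlg C) where
  comul := coeffComul C
  counit := pairing C 1
  coassoc := by
    refine LinearMap.ext fun a => evTensor_injective toDual_injective ev₂_injective ?_
    ext u v w
    simp only [TensorProduct.AlgebraTensorModule.curry_apply, LinearMap.restrictScalars_self,
      TensorProduct.curry_apply, LinearMap.comp_apply, LinearEquiv.coe_coe]
    rw [ev₃_rTensor, ev₃_lTensor, ev₂_coeffComul, ev₂_coeffComul, mul_assoc]
  rTensor_counit_comp_comul := by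
    refine LinearMap.ext fun a => (TensorProduct.lid ℂ _).injective (toDual_injective ?_)
    ext u
    rw [LinearMap.comp_apply, toDual_lid_pairing, ev₂_coeffComul]
    simp
  lTensor_counit_comp_comul := by
    refine LinearMap.ext fun a => (TensorProduct.rid ℂ _).injective (toDual_injective ?_)
    ext u
    rw [LinearMap.comp_apply, toDual_rid_pairing, ev₂_coeffComul]
    simp

/-! ### Left coideal subalgebras and their invariants -/

variable (U) in
/-- A left coideal subalgebra `K` of `U`: a unital subalgebra with `Δ(K) ⊆ U ⊗ K`. -/
structure LeftCoidealSubalgebra extends Subalgebra ℂ U where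
  comul_mem : ∀ k ∈ toSubalgebra,
    comul k ∈ LinearMap.range (toSubalgebra.toSubmodule.subtype.lTensor U)

/-- `K` is `C`-semisimple: the restriction to `K` of every module in `C` is a direct sum of
irreducible `K`-modules. -/
def IsCSemisimple (C : FinRep U → Prop) (K : LeftCoidealSubalgebra U) : Prop :=
  ∀ M : FinRep U, C M →
    letI : Module K.toSubalgebra M.V :=
      Module.compHom M.V (M.ρ.comp K.toSubalgebra.val).toRingHom
    IsSemisimpleModule K.toSubalgebra M.V

variable (K : LeftCoidealSubalgebra U)

/-- The condition `⟨k, b₍₁₎⟩ b₍₂₎ = 0` for all `k ∈ K⁺ = {k - ε(k) | k ∈ K}`. -/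
def IsInvariant (b : coeffAlg C) : Prop :=
  ∀ k ∈ K.toSubalgebra, TensorProduct.lid ℂ (coeffAlg C)
    ((pairing C (k - algebraMap ℂ U (counit k))).rTensor (coeffAlg C) (comul b)) = 0

variable {K}

lemma isInvariant_iff (b : coeffAlg C) : IsInvariant K b ↔
    ∀ k ∈ K.toSubalgebra, ∀ u, toDual C b (k * u) = counit (R := ℂ) k * toDual C b u := by
  refine forall₂_congr fun k _ => ?_
  rw [← toDual_injective.eq_iff, LinearMap.ext_iff]
  refine forall_congr' fun u => ?_
  rw [toDual_lid_pairing]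
  change ev₂ C (coeffComul C b) _ = _ ↔ _
  rw [ev₂_coeffComul, sub_mul, map_sub, ← Algebra.smul_def, map_smul, map_zero,
    LinearMap.zero_apply, sub_eq_zero, smul_eq_mul]

lemma dualDistrib_mul_of_mem (b c : coeffAlg C) (hc : IsInvariant K c) (s : U ⊗[ℂ] U)
    (hs : s ∈ LinearMap.range (K.toSubalgebra.toSubmodule.subtype.lTensor U)) (w : U ⊗[ℂ] U) :
    TensorProduct.dualDistrib ℂ U U (toDual C b ⊗ₜ toDual C c) (s * w) =
      TensorProduct.dualDistrib ℂ U U (toDual C b ⊗ₜ toDual C c)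
        ((TensorProduct.rid ℂ U (counit.lTensor U s) ⊗ₜ 1) * w) := by
  rw [isInvariant_iff] at hc
  obtain ⟨s, rfl⟩ := hs
  induction s with
  | zero => simp
  | add x y hx hy => simp only [map_add, add_mul, hx, hy, TensorProduct.add_tmul]
  | tmul p q =>
    induction w with
    | zero => simp
    | add x y hx hy => simp only [map_add, mul_add, hx, hy]
    | tmul x y =>
      simp only [LinearMap.lTensor_tmul, Algebra.TensorProduct.tmul_mul_tmul,
        TensorProduct.dualDistrib_apply, TensorProduct.rid_tmul, one_mul, Submodule.subtype_apply]
      rw [hc q q.2, smul_mul_assoc, map_smul, smul_eq_mul]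
      ring

variable (C K) in
/-- The algebra `B` of `K`-invariants in `A = U⁰_C`. -/
def invSubalgebra : Subalgebra ℂ (coeffAlg C) where
  carrier := {b | IsInvariant K b}
  add_mem' {a b} ha hb := by
    intro k hk
    rw [map_add, map_add, map_add, ha k hk, hb k hk, add_zero]
  mul_mem' {a b} ha hb := by
    have ha' := (isInvariant_iff a).1 ha
    refine (isInvariant_iff _).2 fun k hk u => ?_
    rw [toDual_mul, toDual_mul, Bialgebra.comul_mul, dualDistrib_mul_of_mem a b hb _
      (K.comul_mem k hk), Coalgebra.lTensor_counit_comul]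
    generalize (comul u : U ⊗[ℂ] U) = w
    induction w with
    | zero => simp
    | add x y hx hy => simp only [map_add, mul_add, hx, hy]
    | tmul x y => simp [ha' k hk, mul_assoc]
  algebraMap_mem' r := by
    refine (isInvariant_iff _).2 fun k _ u => ?_
    change r * counit (R := ℂ) (k * u) = counit (R := ℂ) k * (r * counit (R := ℂ) u)
    rw [Bialgebra.counit_mul]
    ring

variable (C K) in
/-- The algebra `B` as a type. -/
def invAlg : Type u := invSubalgebra C K

instance : Ring (invAlg C K) := inferInstanceAs (Ring (invSubalgebra C K))

instance : Algebra ℂ (invAlg C K) := inferInstanceAs (Algebra ℂ (invSubalgebra C K))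

variable (C K) in
/-- The inclusion of `B` into `A`. -/
def invIncl : invAlg C K →ₐ[ℂ] coeffAlg C := (invSubalgebra C K).val

lemma isInvariant_invIncl (b : invAlg C K) : IsInvariant K (invIncl C K b) := b.2

lemma toDual_invIncl_injective : Function.Injective (toDual C ∘ₗ (invIncl C K).toLinearMap) :=
  toDual_injective.comp Subtype.val_injective

lemma invAlg_comul_mem (b : invAlg C K) :
    ((LinearMap.mul' ℂ U).dualMap ∘ₗ toDual C ∘ₗ (invIncl C K).toLinearMap) b ∈
      LinearMap.range (evTensor (toDual C ∘ₗ (invIncl C K).toLinearMap) (toDual C)) := by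
  have hinv := (isInvariant_iff (invIncl C K b)).1 (isInvariant_invIncl b)
  have hev : ∀ u v, ev₂ C (coeffComul C (invIncl C K b)) (u ⊗ₜ v) = toDual C (invIncl C K b) (u * v) :=
    ev₂_coeffComul (invIncl C K b)
  apply mem_range_evTensor
  · exact finite_range_of_mem_range_evTensor (coeffAlg_comul_mem (invIncl C K b))
  · intro v
    refine ⟨⟨TensorProduct.rid ℂ _ ((pairing C v).lTensor (coeffAlg C) (coeffComul C (invIncl C K b))),
      (isInvariant_iff _).2 fun k hk u => ?_⟩, ?_⟩
    · rw [toDual_rid_pairing, toDual_rid_pairing, hev, hev, mul_assoc, hinv k hk]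
    · ext u
      exact (toDual_rid_pairing _ _ _).trans (hev u v)
  · intro u
    refine ⟨TensorProduct.lid ℂ _ ((pairing C u).rTensor (coeffAlg C) (coeffComul C (invIncl C K b))), ?_⟩
    ext v
    exact (toDual_lid_pairing _ _ _).trans (hev u v)

variable (C K) in
/-- The right coaction `B → B ⊗ A` given by the comultiplication of `A`. -/
def invCoaction : invAlg C K →ₗ[ℂ] invAlg C K ⊗[ℂ] coeffAlg C :=
  liftThrough (evTensor (toDual C ∘ₗ (invIncl C K).toLinearMap) (toDual C))
    (evTensor_injective toDual_invIncl_injective toDual_injective)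
    ((LinearMap.mul' ℂ U).dualMap ∘ₗ toDual C ∘ₗ (invIncl C K).toLinearMap) invAlg_comul_mem

lemma rTensor_invCoaction (b : invAlg C K) :
    (invIncl C K).toLinearMap.rTensor (coeffAlg C) (invCoaction C K b) = comul (invIncl C K b) := by
  apply ev₂_injective
  have h := apply_liftThrough (evTensor (toDual C ∘ₗ (invIncl C K).toLinearMap) (toDual C))
    (evTensor_injective toDual_invIncl_injective toDual_injective)
    ((LinearMap.mul' ℂ U).dualMap ∘ₗ toDual C ∘ₗ (invIncl C K).toLinearMap) invAlg_comul_mem b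
  ext u v
  have h' := LinearMap.congr_fun h (u ⊗ₜ v)
  have h'' := ev₂_coeffComul (invIncl C K b) u v
  refine Eq.trans ?_ (h'.trans (Eq.trans ?_ h''.symm))
  · simp only [TensorProduct.AlgebraTensorModule.curry_apply, LinearMap.restrictScalars_self,
      TensorProduct.curry_apply]
    change _ = evTensor (toDual C ∘ₗ (invIncl C K).toLinearMap) (toDual C) (invCoaction C K b) _
    generalize invCoaction C K b = t
    induction t with
    | zero => simp
    | add x y hx hy => simp only [map_add, LinearMap.add_apply, hx, hy]
    | tmul x y => simp
  · simp

variable (C K) in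
/-- The counit of `B`, i.e. evaluation at `1 ∈ U`. -/
def invCounit : invAlg C K →ₐ[ℂ] ℂ :=
  AlgHom.ofLinearMap (pairing C 1 ∘ₗ (invIncl C K).toLinearMap)
    (by
      change toDual C 1 1 = 1
      rw [toDual_one, Bialgebra.counit_one])
    (fun a b => by
      change toDual C (invIncl C K a * invIncl C K b) 1 = toDual C (invIncl C K a) 1 * toDual C (invIncl C K b) 1
      rw [toDual_mul, Bialgebra.comul_one, Algebra.TensorProduct.one_def,
        TensorProduct.dualDistrib_apply])

/-- The right action of `k ∈ U` on functionals on `B`: `(f k)(b) = f(b₍₁₎) ⟨k, b₍₂₎⟩`. -/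
def dualAct (f : Dual ℂ (invAlg C K)) (k : U) : Dual ℂ (invAlg C K) :=
  LinearMap.mul' ℂ ℂ ∘ₗ TensorProduct.map f (pairing C k) ∘ₗ invCoaction C K

/-- The subspaces of `B°` on the dual side of the correspondence: `T ⊆ B°` has dimension `n + 1`,
contains `ε`, and satisfies `ΔT ⊆ B° ⊗ T` and `TK ⊆ T`. -/
structure IsTangentSpace (n : ℕ) (T : Submodule ℂ (finDual (invAlg C K))) : Prop where
  dim : Module.finrank ℂ T = n + 1
  counit_mem : finDualOfChar (invCounit C K) ∈ T
  comul_mem : ∀ f ∈ T,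
    finDualComul f ∈ LinearMap.range (T.subtype.lTensor (finDual (invAlg C K)))
  act_mem : ∀ f ∈ T, ∀ k ∈ K.toSubalgebra, ∃ g ∈ T, g.1 = dualAct f.1 k

end Reps

/-! ### First order differential calculi -/

section FODC

/-- A first order differential calculus over `B`: a `B`-bimodule `Γ` with a linear map
`d : B → Γ` satisfying the Leibniz rule, such that `Γ` is the linear span of the elements
`a (db) c`. The right action of `c` is `MulOpposite.op c • ·`. -/
structure FODC (B : Type u) [Ring B] [Algebra ℂ B] where
  Γ : Type u
  [addCommGroup : AddCommGroup Γ]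
  [module : Module ℂ Γ]
  [leftModule : Module B Γ]
  [rightModule : Module Bᵐᵒᵖ Γ]
  [leftTower : IsScalarTower ℂ B Γ]
  [rightTower : IsScalarTower ℂ Bᵐᵒᵖ Γ]
  [bimodule : SMulCommClass B Bᵐᵒᵖ Γ]
  d : B →ₗ[ℂ] Γ
  leibniz : ∀ a b, d (a * b) = a • d b + MulOpposite.op b • d a
  span_eq_top : Submodule.span ℂ {ω : Γ | ∃ a b c : B, ω = MulOpposite.op c • a • d b} = ⊤

attribute [instance] FODC.addCommGroup FODC.module FODC.leftModule FODC.rightModule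
  FODC.leftTower FODC.rightTower FODC.bimodule

namespace FODC

variable {B : Type u} [Ring B] [Algebra ℂ B]

/-- Isomorphism of calculi: a bimodule isomorphism compatible with the differentials. -/
def Iso (X Y : FODC B) : Prop :=
  ∃ φ : X.Γ ≃ₗ[ℂ] Y.Γ, (∀ (b : B) ω, φ (b • ω) = b • φ ω) ∧
    (∀ (b : B) ω, φ (MulOpposite.op b • ω) = MulOpposite.op b • φ ω) ∧ ∀ b, φ (X.d b) = Y.d b

lemma iso_equivalence : Equivalence (Iso (B := B)) where
  refl X := ⟨LinearEquiv.refl _ _, by simp⟩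
  symm := by
    rintro X Y ⟨φ, h1, h2, h3⟩
    exact ⟨φ.symm, fun b ω => by simp [LinearEquiv.symm_apply_eq, h1],
      fun b ω => by simp [LinearEquiv.symm_apply_eq, h2],
      fun b => by simp [LinearEquiv.symm_apply_eq, h3]⟩
  trans := by
    rintro X Y Z ⟨φ, h1, h2, h3⟩ ⟨ψ, k1, k2, k3⟩
    exact ⟨φ.trans ψ, fun b ω => by simp [h1, k1], fun b ω => by simp [h2, k2],
      fun b => by simp [h3, k3]⟩

/-- The left action `B → End Γ`. -/
def lact (X : FODC B) : B →ₗ[ℂ] X.Γ →ₗ[ℂ] X.Γ := (Algebra.lsmul ℂ ℂ X.Γ).toLinearMap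

/-- The right action `B → End Γ`. -/
def ract (X : FODC B) : B →ₗ[ℂ] X.Γ →ₗ[ℂ] X.Γ :=
  (Algebra.lsmul ℂ ℂ X.Γ : Bᵐᵒᵖ →ₐ[ℂ] _).toLinearMap ∘ₗ
    (MulOpposite.opLinearEquiv ℂ : B ≃ₗ[ℂ] Bᵐᵒᵖ).toLinearMap

/-- Right covariance of a calculus over `B` with respect to a coaction `δ : B → B ⊗ A`: there is a
right coaction `Φ : Γ → Γ ⊗ A` with `Φ(bω) = δ(b)Φ(ω)`, `Φ(ωb) = Φ(ω)δ(b)` and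
`Φ(db) = (d ⊗ id)δ(b)`. -/
def IsCovariant {A : Type*} [Ring A] [Algebra ℂ A] [Coalgebra ℂ A] (δ : B →ₗ[ℂ] B ⊗[ℂ] A)
    (X : FODC B) : Prop :=
  ∃ Φ : X.Γ →ₗ[ℂ] X.Γ ⊗[ℂ] A,
    (∀ ω, TensorProduct.assoc ℂ X.Γ A A (Φ.rTensor A (Φ ω)) = comul.lTensor X.Γ (Φ ω)) ∧
    (∀ ω, TensorProduct.rid ℂ X.Γ (counit.lTensor X.Γ (Φ ω)) = ω) ∧
    (∀ (b : B) ω, Φ (b • ω) = TensorProduct.map₂ X.lact (LinearMap.mul ℂ A) (δ b) (Φ ω)) ∧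
    (∀ (b : B) ω, Φ (MulOpposite.op b • ω) =
      TensorProduct.map₂ X.ract (LinearMap.mul ℂ A).flip (δ b) (Φ ω)) ∧
    ∀ b, Φ (X.d b) = X.d.rTensor A (δ b)

/-- The subspace `Γ B⁺`, where `B⁺ = ker χ`. -/
def augSub (χ : B →ₐ[ℂ] ℂ) (X : FODC B) : Submodule ℂ X.Γ :=
  Submodule.span ℂ {η | ∃ ω : X.Γ, ∃ b : B, χ b = 0 ∧ η = MulOpposite.op b • ω}

/-- The calculus has dimension `n`: `dim Γ / Γ B⁺ = n`. -/
def HasDim (χ : B →ₐ[ℂ] ℂ) (n : ℕ) (X : FODC B) : Prop :=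
  Module.rank ℂ (X.Γ ⧸ X.augSub χ) = n

/-- The subspace `L = {∑ᵢ aᵢ⁺ ε(bᵢ) | ∑ᵢ daᵢ bᵢ = 0}` of `B⁺`, where `a⁺ = a - ε(a)`. -/
def leftIdeal (χ : B →ₐ[ℂ] ℂ) (X : FODC B) : Submodule ℂ B :=
  (LinearMap.ker (TensorProduct.lift (X.ract.flip ∘ₗ X.d))).map
    (TensorProduct.rid ℂ B ∘ₗ
      TensorProduct.map (LinearMap.id - Algebra.linearMap ℂ B ∘ₗ χ.toLinearMap) χ.toLinearMap)

/-- The space `T^ε` of functionals on `B` that vanish on `L`; it is spanned by the counit and the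
quantum tangent space of the calculus. -/
def tangentEps (χ : B →ₐ[ℂ] ℂ) (X : FODC B) : Submodule ℂ (Dual ℂ B) :=
  (X.leftIdeal χ).dualAnnihilator

end FODC

end FODC

section Classes

variable {U : Type u} [Ring U] [HopfAlgebra ℂ U]

/-- The `n`-dimensional covariant calculi over `B`. -/
def CovFODC (C : FinRep U → Prop) (K : LeftCoidealSubalgebra U) (n : ℕ) : Type (u + 1) :=
  {X : FODC (invAlg C K) // X.IsCovariant (invCoaction C K) ∧ X.HasDim (invCounit C K) n}

/-- Calculi are considered up to isomorphism. -/
instance covFODCSetoid (C : FinRep U → Prop) (K : LeftCoidealSubalgebra U) (n : ℕ) :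
    Setoid (CovFODC C K n) where
  r X Y := FODC.Iso X.1 Y.1
  iseqv := ⟨fun X => FODC.iso_equivalence.refl X.1, fun h => FODC.iso_equivalence.symm h,
    fun h k => FODC.iso_equivalence.trans h k⟩

end Classes

end QTangent

end

/-! By the Leibniz rule a calculus is spanned by the elements `da b`. It is therefore the quotient
of `B ⊗ B` by the kernel `N` of `a ⊗ b ↦ da b` (`FODC.relMap`), and `N` determines it up to
isomorphism (`FODC.iso_of_ker_eq`). The subspaces that occur are those of `FODC.IsRelations`. An
`A`-coaction amounts to a `U`-action with coefficients in `A`, so covariance means that `N` is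
stable under the diagonal action of `U`: covariant calculi are certain Hopf submodules of `B ⊗ B`.

Such an `N` is recovered from its fibre `(id ⊗ ε)(N) ⊆ B`, in the spirit of Takeuchi's equivalence.
The fibre is `K`-stable, because elements of `B` are left `K`-invariant and hence `ε(kb) =
ε(k)ε(b)`. To `t ∈ B ⊗ B` one attaches the `K`-equivariant function `u ↦ (id ⊗ ε)(ut) = u₍₁₎
t(u₍₂₎)`, where `t` is read as a `B`-valued function through its second factor. The operation `F ↦
S(u₍₁₎) F(u₍₂₎)` undoes this twist and turns `K`-equivariant functions with coefficients in `A` into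
`K`-invariant ones, that is, into tensors whose second factor lies in `B`. Semisimplicity of `K`
supplies equivariant maps to compose such functions with. A section over the fibre shows that `N`
contains every `U`-stable subspace whose fibre is no larger (`le_of_map_evalSnd_le`, giving
injectivity). A projection onto a `K`-stable `L` shows that `coind L` has fibre `L`
(`map_evalSnd_coind`, giving surjectivity).

The rest is linear duality. The fibre is `L_Γ ⊕ ℂ1` with `L_Γ` a `K`-stable left ideal inside `B⁺`,
and `Γ / ΓB⁺` is `B` modulo the fibre, so `L_Γ` has codimension `n + 1`. Its annihilator lies in
`B°`, and the three conditions on `T^ε` are dual to `L_Γ ⊆ B⁺`, to the left ideal property and to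
`K`-stability. Finite dimension makes the passage to annihilators reversible. -/

noncomputable section

namespace QTangent

/-! ### Tensors as finite rank maps -/

section EvalRight

variable {V Y M N : Type*} [AddCommGroup V] [Module ℂ V] [AddCommGroup Y] [Module ℂ Y]
  [AddCommGroup M] [Module ℂ M] [AddCommGroup N] [Module ℂ N]

/-- The linear map `V → M` defined by an element of `M ⊗ Y`, where `Y` is a space of functionals
on `V`: `m ⊗ y` acts as `v ↦ y(v) m`. -/
def evalRight (j : Y →ₗ[ℂ] Dual ℂ V) (M : Type*) [AddCommGroup M] [Module ℂ M] :
    M ⊗[ℂ] Y →ₗ[ℂ] V →ₗ[ℂ] M :=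
  TensorProduct.lift (LinearMap.smulRightₗ ∘ₗ j).flip

@[simp] lemma evalRight_tmul (j : Y →ₗ[ℂ] Dual ℂ V) (m : M) (y : Y) (v : V) :
    evalRight j M (m ⊗ₜ y) v = j y v • m := rfl

lemma evalRight_rTensor (j : Y →ₗ[ℂ] Dual ℂ V) (f : M →ₗ[ℂ] N) (t : M ⊗[ℂ] Y) (v : V) :
    evalRight j N (f.rTensor Y t) v = f (evalRight j M t v) := by
  induction t with
  | zero => simp
  | add x y hx hy => simp only [map_add, LinearMap.add_apply, hx, hy]
  | tmul m y => simp

lemma evalRight_lTensor {Y' : Type*} [AddCommGroup Y'] [Module ℂ Y'] (j : Y →ₗ[ℂ] Dual ℂ V)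
    (i : Y' →ₗ[ℂ] Y) (t : M ⊗[ℂ] Y') :
    evalRight j M (i.lTensor M t) = evalRight (j ∘ₗ i) M t := by
  induction t with
  | zero => simp
  | add x y hx hy => simp only [map_add, hx, hy]
  | tmul m y => rfl

lemma evalRight_sum_basis (j : Y →ₗ[ℂ] Dual ℂ V) {ι : Type*} (b : Basis ι ℂ M) (c : ι →₀ Y) (v : V)
    (k : ι) : b.repr (evalRight j M (c.sum fun i y => b i ⊗ₜ y) v) k = j (c k) v := by
  classical
  by_cases hk : k ∈ c.support
  · simp [Finsupp.sum, LinearMap.sum_apply, Finsupp.single_apply]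
    intro h
    simp [h]
  · simp [Finsupp.sum, LinearMap.sum_apply, Finsupp.single_apply]
    intro h
    simp [h]

lemma evalRight_injective {j : Y →ₗ[ℂ] Dual ℂ V} (hj : Function.Injective j) :
    Function.Injective (evalRight j M) := by
  rw [injective_iff_map_eq_zero]
  intro t ht
  obtain ⟨c, rfl⟩ := TensorProduct.eq_repr_basis_left (Basis.ofVectorSpace ℂ M) t
  suffices h : c = 0 by simp [h]
  ext k
  apply hj
  ext v
  rw [← evalRight_sum_basis j (Basis.ofVectorSpace ℂ M) c v k, ht]
  simp

lemma evalRight_ext {j : Y →ₗ[ℂ] Dual ℂ V} (hj : Function.Injective j) {s t : M ⊗[ℂ] Y}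
    (h : ∀ v, evalRight j M s v = evalRight j M t v) : s = t :=
  evalRight_injective hj (LinearMap.ext h)

/-- A tensor all of whose slices lie in a subspace `P` comes from `P ⊗ Y`. -/
lemma mem_range_rTensor_subtype {j : Y →ₗ[ℂ] Dual ℂ V} (hj : Function.Injective j)
    (P : Submodule ℂ M) (t : M ⊗[ℂ] Y) (h : ∀ v, evalRight j M t v ∈ P) :
    t ∈ LinearMap.range (P.subtype.rTensor Y) := by
  refine (rTensor_exact Y (LinearMap.exact_subtype_mkQ P) P.mkQ_surjective t).1 ?_
  refine evalRight_ext hj fun v => ?_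
  rw [evalRight_rTensor, map_zero, LinearMap.zero_apply, Submodule.mkQ_apply,
    Submodule.Quotient.mk_eq_zero]
  exact h v

/-- A tensor whose coefficients satisfy a family of linear conditions defining the image of `Y'` in
`Y` comes from `M ⊗ Y'`. -/
lemma mem_range_lTensor {Y' : Type*} [AddCommGroup Y'] [Module ℂ Y'] (i : Y' →ₗ[ℂ] Y)
    (t : M ⊗[ℂ] Y)
    (h : ∀ φ : Dual ℂ M, TensorProduct.lid ℂ Y (φ.rTensor Y t) ∈ LinearMap.range i) :
    t ∈ LinearMap.range (i.lTensor M) := by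
  classical
  obtain ⟨ι, ⟨b⟩⟩ : ∃ ι : Set M, Nonempty (Basis ι ℂ M) := ⟨_, ⟨Basis.ofVectorSpace ℂ M⟩⟩
  obtain ⟨c, rfl⟩ := TensorProduct.eq_repr_basis_left b t
  refine Submodule.sum_mem _ fun k hk => ?_
  obtain ⟨y, hy⟩ := h (b.coord k)
  refine ⟨b k ⊗ₜ y, ?_⟩
  have h0 : i y = c k := by
    rw [hy, Finsupp.sum, map_sum, map_sum, Finset.sum_eq_single k]
    · simp
    · intro l _ hl
      simp [hl]
    · intro hk'
      exact absurd hk hk'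
  rw [LinearMap.lTensor_tmul, h0]

lemma evalRight_lid (j : Y →ₗ[ℂ] Dual ℂ V) (φ : Dual ℂ M) (t : M ⊗[ℂ] Y) (v : V) :
    j (TensorProduct.lid ℂ Y (φ.rTensor Y t)) v = φ (evalRight j M t v) := by
  induction t with
  | zero => simp
  | add x y hx hy => simp only [map_add, LinearMap.add_apply, hx, hy]
  | tmul m y => simp [mul_comm]

end EvalRight

/-! ### Twisting by a representation -/

section Twist

variable {U : Type u} [Ring U] [HopfAlgebra ℂ U] {M : Type*} [AddCommGroup M] [Module ℂ M]

/-- `F ↦ (u ↦ u₍₁₎ F(u₍₂₎))`. -/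
def twist (ρ : U →ₐ[ℂ] Module.End ℂ M) (F : U →ₗ[ℂ] M) : U →ₗ[ℂ] M :=
  TensorProduct.lift ρ.toLinearMap ∘ₗ F.lTensor U ∘ₗ comul

/-- `F ↦ (u ↦ S(u₍₁₎) F(u₍₂₎))`. -/
def untwist (ρ : U →ₐ[ℂ] Module.End ℂ M) (F : U →ₗ[ℂ] M) : U →ₗ[ℂ] M :=
  TensorProduct.lift (ρ.toLinearMap ∘ₗ HopfAlgebra.antipode ℂ) ∘ₗ F.lTensor U ∘ₗ comul

/-- By coassociativity the composite is `S(u₍₁₎)u₍₂₎ F(u₍₃₎)`, and the antipode axiom collapses the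
first two legs. `key` is this regrouping before the axiom is applied. The opposite composite uses
`u₍₁₎S(u₍₂₎) = ε(u)` in the same way. -/
lemma untwist_twist (ρ : U →ₐ[ℂ] Module.End ℂ M) (F : U →ₗ[ℂ] M) :
    untwist ρ (twist ρ F) = F := by
  ext u
  have key : TensorProduct.lift (ρ.toLinearMap ∘ₗ HopfAlgebra.antipode ℂ) ∘ₗ
      (TensorProduct.lift ρ.toLinearMap ∘ₗ F.lTensor U).lTensor U ∘ₗ
        (TensorProduct.assoc ℂ U U U).toLinearMap =
      TensorProduct.lift ρ.toLinearMap ∘ₗ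
        TensorProduct.map (LinearMap.mul' ℂ U ∘ₗ (HopfAlgebra.antipode ℂ).rTensor U) F := by
    apply TensorProduct.ext_threefold
    intro x y z
    simp
  have h1 : untwist ρ (twist ρ F) u = TensorProduct.lift (ρ.toLinearMap ∘ₗ HopfAlgebra.antipode ℂ)
      ((TensorProduct.lift ρ.toLinearMap ∘ₗ F.lTensor U).lTensor U (comul.lTensor U (comul u))) := by
    rw [← LinearMap.lTensor_comp_apply]
    rfl
  rw [h1, ← coassoc_apply]
  refine (LinearMap.congr_fun key _).trans ?_
  rw [LinearMap.comp_apply, ← LinearMap.comp_apply (TensorProduct.map _ _), LinearMap.map_comp_rTensor]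
  rw [LinearMap.comp_assoc, HopfAlgebra.mul_antipode_rTensor_comul, ← LinearMap.map_comp_rTensor,
    LinearMap.comp_apply, rTensor_counit_comul]
  simp

lemma twist_untwist (ρ : U →ₐ[ℂ] Module.End ℂ M) (F : U →ₗ[ℂ] M) :
    twist ρ (untwist ρ F) = F := by
  ext u
  have key : TensorProduct.lift ρ.toLinearMap ∘ₗ
      (TensorProduct.lift (ρ.toLinearMap ∘ₗ HopfAlgebra.antipode ℂ) ∘ₗ F.lTensor U).lTensor U ∘ₗ
        (TensorProduct.assoc ℂ U U U).toLinearMap =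
      TensorProduct.lift ρ.toLinearMap ∘ₗ
        TensorProduct.map (LinearMap.mul' ℂ U ∘ₗ (HopfAlgebra.antipode ℂ).lTensor U) F := by
    apply TensorProduct.ext_threefold
    intro x y z
    simp
  have h1 : twist ρ (untwist ρ F) u = TensorProduct.lift ρ.toLinearMap
      ((TensorProduct.lift (ρ.toLinearMap ∘ₗ HopfAlgebra.antipode ℂ) ∘ₗ F.lTensor U).lTensor U
        (comul.lTensor U (comul u))) := by
    rw [← LinearMap.lTensor_comp_apply]
    rfl
  rw [h1, ← coassoc_apply]
  refine (LinearMap.congr_fun key _).trans ?_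
  rw [LinearMap.comp_apply, ← LinearMap.comp_apply (TensorProduct.map _ _), LinearMap.map_comp_rTensor]
  rw [LinearMap.comp_assoc, HopfAlgebra.mul_antipode_lTensor_comul, ← LinearMap.map_comp_rTensor,
    LinearMap.comp_apply, rTensor_counit_comul]
  simp

/-- If `F` is `K`-equivariant then `u ↦ S(u₍₁₎) F(u₍₂₎)` is `K`-invariant. -/
lemma untwist_mul_left (K : LeftCoidealSubalgebra U) (ρ : U →ₐ[ℂ] Module.End ℂ M) (F : U →ₗ[ℂ] M)
    (hF : ∀ k ∈ K.toSubalgebra, ∀ u, F (k * u) = ρ k (F u)) (k : U) (hk : k ∈ K.toSubalgebra)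
    (u : U) : untwist ρ F (k * u) = counit (R := ℂ) k • untwist ρ F u := by
  -- For `s = p ⊗ q` with `q ∈ K`, equivariance gives `S(px) F(qy) = S(x) S(p) q F(y)`. Only `S(p)q`
  -- enters, and for `s = Δ(k)` it becomes `ε(k)`.
  have key : ∀ s ∈ LinearMap.range (K.toSubalgebra.toSubmodule.subtype.lTensor U), ∀ w : U ⊗[ℂ] U,
      TensorProduct.lift (ρ.toLinearMap ∘ₗ HopfAlgebra.antipode ℂ) (F.lTensor U (s * w)) =
      TensorProduct.lift (ρ.toLinearMap ∘ₗ
        LinearMap.mulRight ℂ (LinearMap.mul' ℂ U ((HopfAlgebra.antipode ℂ).rTensor U s)) ∘ₗ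
          HopfAlgebra.antipode ℂ) (F.lTensor U w) := by
    rintro _ ⟨s, rfl⟩ w
    induction w with
    | zero => simp
    | add x y hx hy => simp only [map_add, mul_add, hx, hy]
    | tmul x y =>
      induction s with
      | zero => simp
      | add s t hs ht =>
        simp only [map_add, add_mul, mul_add, hs, ht, TensorProduct.lift.tmul, LinearMap.comp_apply,
          LinearMap.mulRight_apply, AlgHom.toLinearMap_apply, LinearMap.lTensor_tmul,
          LinearMap.add_apply]
      | tmul p q =>
        simp [hF q q.2, HopfAlgebra.antipode_mul_antidistrib]
  rw [untwist, LinearMap.comp_apply, LinearMap.comp_apply, Bialgebra.comul_mul,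
    key _ (K.comul_mem k hk), HopfAlgebra.mul_antipode_rTensor_comul_apply]
  have : LinearMap.mulRight ℂ (algebraMap ℂ U (counit k)) = counit (R := ℂ) k • LinearMap.id := by
    ext x
    simp [Algebra.algebraMap_eq_smul_one]
  rw [this]
  simp only [LinearMap.comp_apply]
  generalize (comul u : U ⊗[ℂ] U) = w
  induction w with
  | zero => simp
  | add x y hx hy => simp only [map_add, hx, hy, smul_add]
  | tmul x y => simp

end Twist

/-! ### Regular representations -/

section Regular

variable {U : Type u} [Ring U] [HopfAlgebra ℂ U] {C : FinRep U → Prop}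

lemma ev₂_eq_evalRight (t : coeffAlg C ⊗[ℂ] coeffAlg C) (u v : U) :
    ev₂ C t (u ⊗ₜ v) = toDual C (evalRight (toDual C) (coeffAlg C) t v) u := by
  induction t with
  | zero => simp
  | add x y hx hy => simp only [map_add, LinearMap.add_apply, hx, hy]
  | tmul a b => simp [mul_comm]

lemma toDual_evalRight_comul (a : coeffAlg C) (u v : U) :
    toDual C (evalRight (toDual C) (coeffAlg C) (coeffComul C a) u) v = toDual C a (v * u) := by
  rw [← ev₂_eq_evalRight, ev₂_coeffComul]

variable (C) in
/-- The regular representation of `U` on `A`: `(u a)(v) = a(vu)`. -/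
def regRep : U →ₐ[ℂ] Module.End ℂ (coeffAlg C) :=
  AlgHom.ofLinearMap (evalRight (toDual C) (coeffAlg C) ∘ₗ coeffComul C).flip
    (by
      refine LinearMap.ext fun a => toDual_injective (LinearMap.ext fun v => ?_)
      refine (toDual_evalRight_comul a 1 v).trans ?_
      rw [mul_one]
      rfl)
    (fun x y => by
      refine LinearMap.ext fun a => toDual_injective (LinearMap.ext fun v => ?_)
      refine (toDual_evalRight_comul a (x * y) v).trans (Eq.symm ?_)
      refine (toDual_evalRight_comul _ x v).trans ?_
      refine (toDual_evalRight_comul a y (v * x)).trans ?_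
      rw [mul_assoc])

lemma toDual_regRep (u : U) (a : coeffAlg C) (v : U) :
    toDual C (regRep C u a) v = toDual C a (v * u) :=
  toDual_evalRight_comul a u v

variable {K : LeftCoidealSubalgebra U}

variable (C K) in
/-- Elements of `B` as functionals on `U`. -/
abbrev invDual : invAlg C K →ₗ[ℂ] Dual ℂ U := toDual C ∘ₗ (invIncl C K).toLinearMap

lemma invDual_mul_left (b : invAlg C K) (k : U) (hk : k ∈ K.toSubalgebra) (u : U) :
    invDual C K b (k * u) = counit (R := ℂ) k * invDual C K b u :=
  (isInvariant_iff _).1 (isInvariant_invIncl b) k hk u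

lemma invDual_mul (b c : invAlg C K) (u : U) : invDual C K (b * c) u =
    TensorProduct.dualDistrib ℂ U U (invDual C K b ⊗ₜ invDual C K c) (comul u) :=
  toDual_mul (invIncl C K b) (invIncl C K c) u

lemma invDual_one (u : U) : invDual C K 1 u = counit (R := ℂ) u := rfl

lemma invCounit_apply (b : invAlg C K) : invCounit C K b = invDual C K b 1 := rfl

lemma invDual_evalRight_coaction (b : invAlg C K) (u v : U) :
    invDual C K (evalRight (toDual C) (invAlg C K) (invCoaction C K b) u) v =
      invDual C K b (v * u) := by
  rw [LinearMap.comp_apply, ← evalRight_rTensor, rTensor_invCoaction]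
  exact toDual_evalRight_comul _ u v

variable (C K) in
/-- The regular representation of `U` on `B`: `(u b)(v) = b(vu)`. -/
def invReg : U →ₐ[ℂ] Module.End ℂ (invAlg C K) :=
  AlgHom.ofLinearMap (evalRight (toDual C) (invAlg C K) ∘ₗ invCoaction C K).flip
    (by
      refine LinearMap.ext fun a => toDual_invIncl_injective (LinearMap.ext fun v => ?_)
      refine (invDual_evalRight_coaction a 1 v).trans ?_
      rw [mul_one]
      rfl)
    (fun x y => by
      refine LinearMap.ext fun a => toDual_invIncl_injective (LinearMap.ext fun v => ?_)
      refine (invDual_evalRight_coaction a (x * y) v).trans (Eq.symm ?_)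
      refine (invDual_evalRight_coaction _ x v).trans ?_
      refine (invDual_evalRight_coaction a y (v * x)).trans ?_
      rw [mul_assoc])

lemma evalRight_invCoaction (b : invAlg C K) (u : U) :
    evalRight (toDual C) (invAlg C K) (invCoaction C K b) u = invReg C K u b := rfl

lemma invDual_invReg (u : U) (b : invAlg C K) (v : U) :
    invDual C K (invReg C K u b) v = invDual C K b (v * u) :=
  invDual_evalRight_coaction b u v

/-- An element of `B` is recovered from its translates by the counit alone; this is why applying `id
⊗ ε` after the action of `U` loses no information on `B ⊗ B`. -/
lemma invCounit_invReg (u : U) (b : invAlg C K) :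
    invCounit C K (invReg C K u b) = invDual C K b u := by
  rw [invCounit_apply, invDual_invReg, one_mul]

lemma invReg_one (u : U) : invReg C K u 1 = counit (R := ℂ) u • 1 := by
  refine toDual_invIncl_injective (LinearMap.ext fun v => ?_)
  refine (invDual_invReg u 1 v).trans ?_
  rw [invDual_one, map_smul, LinearMap.smul_apply]
  change _ = _ * counit v
  rw [Bialgebra.counit_mul, mul_comm]

lemma invReg_mul (u : U) (b c : invAlg C K) : invReg C K u (b * c) =
    LinearMap.mul' ℂ _ (TensorProduct.map ((invReg C K).toLinearMap.flip b)
      ((invReg C K).toLinearMap.flip c) (comul u)) := by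
  refine toDual_invIncl_injective (LinearMap.ext fun v => ?_)
  refine (invDual_invReg u _ v).trans ?_
  rw [invDual_mul, Bialgebra.comul_mul]
  change _ = invDual C K _ v
  generalize (comul u : U ⊗[ℂ] U) = s
  induction s with
  | zero => simp
  | add x y hx hy => simp only [map_add, mul_add, LinearMap.add_apply, hx, hy]
  | tmul x y =>
    simp only [TensorProduct.map_tmul, LinearMap.mul'_apply, invDual_mul]
    generalize (comul v : U ⊗[ℂ] U) = t
    induction t with
    | zero => simp
    | add x y hx hy => simp only [map_add, add_mul, hx, hy]
    | tmul p q =>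
      simp only [Algebra.TensorProduct.tmul_mul_tmul, TensorProduct.dualDistrib_apply,
        LinearMap.flip_apply, AlgHom.toLinearMap_apply, invDual_invReg]

lemma dualAct_apply (f : Dual ℂ (invAlg C K)) (u : U) (b : invAlg C K) :
    dualAct f u b = f (invReg C K u b) := by
  rw [← evalRight_invCoaction, dualAct, LinearMap.comp_apply, LinearMap.comp_apply]
  generalize invCoaction C K b = t
  induction t with
  | zero => simp
  | add x y hx hy => simp only [map_add, LinearMap.add_apply, hx, hy]
  | tmul a b =>
    simp only [TensorProduct.map_tmul, LinearMap.mul'_apply, evalRight_tmul, map_smul, smul_eq_mul]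
    exact mul_comm _ _

end Regular

/-! ### Rational representations -/

section Rational

variable {U : Type u} [Ring U] [HopfAlgebra ℂ U] {C : FinRep U → Prop}
  {M N P : Type*} [AddCommGroup M] [Module ℂ M] [AddCommGroup N] [Module ℂ N]
  [AddCommGroup P] [Module ℂ P]

/-- A representation of `U` is rational if it comes from a coaction of `A = U⁰_C`. -/
def IsRational (C : FinRep U → Prop) (ρ : U →ₐ[ℂ] Module.End ℂ M) : Prop :=
  ∀ m, ρ.toLinearMap.flip m ∈ LinearMap.range (evalRight (toDual C) M)

/-- The coaction of a rational representation. -/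
def IsRational.coaction {ρ : U →ₐ[ℂ] Module.End ℂ M} (h : IsRational C ρ) :
    M →ₗ[ℂ] M ⊗[ℂ] coeffAlg C :=
  liftThrough (evalRight (toDual C) M) (evalRight_injective toDual_injective)
    ρ.toLinearMap.flip h

@[simp] lemma IsRational.evalRight_coaction {ρ : U →ₐ[ℂ] Module.End ℂ M} (h : IsRational C ρ)
    (m : M) (u : U) : evalRight (toDual C) M (h.coaction m) u = ρ u m :=
  LinearMap.congr_fun (apply_liftThrough _ (evalRight_injective toDual_injective)
    ρ.toLinearMap.flip h m) u

lemma isRational_invReg (K : LeftCoidealSubalgebra U) : IsRational C (invReg C K) :=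
  fun b => ⟨invCoaction C K b, rfl⟩

/-- Multiplicativity of evaluation: `⟨u, s t⟩ = ⟨u₍₁₎, s⟩ ⟨u₍₂₎, t⟩`. -/
lemma evalRight_map₂ (f : M →ₗ[ℂ] N →ₗ[ℂ] P) (s : M ⊗[ℂ] coeffAlg C) (t : N ⊗[ℂ] coeffAlg C)
    (u : U) : evalRight (toDual C) P (TensorProduct.map₂ f (LinearMap.mul ℂ _) s t) u =
      TensorProduct.lift f (TensorProduct.map (evalRight (toDual C) M s)
        (evalRight (toDual C) N t) (comul u)) := by
  induction s with
  | zero => simp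
  | add x y hx hy => simp only [map_add, LinearMap.add_apply, hx, hy, TensorProduct.map_add_left]
  | tmul m a =>
    induction t with
    | zero => simp
    | add x y hx hy => simp only [map_add, LinearMap.add_apply, hx, hy, TensorProduct.map_add_right]
    | tmul n b =>
      rw [TensorProduct.map₂_apply_tmul, TensorProduct.map_tmul, evalRight_tmul, LinearMap.mul_apply', toDual_mul]
      generalize (comul u : U ⊗[ℂ] U) = w
      induction w with
      | zero => simp
      | add x y hx hy => simp only [map_add, add_smul, hx, hy]
      | tmul x y => simp [mul_smul, smul_comm (toDual C a x)]

/-- The tensor product of two representations. -/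
def tensorRep (ρ : U →ₐ[ℂ] Module.End ℂ M) (σ : U →ₐ[ℂ] Module.End ℂ N) :
    U →ₐ[ℂ] Module.End ℂ (M ⊗[ℂ] N) :=
  (Module.endTensorEndAlgHom (R := ℂ) (S := ℂ) (A := ℂ)).comp
    ((Algebra.TensorProduct.map ρ σ).comp (Bialgebra.comulAlgHom ℂ U))

lemma tensorRep_tmul (ρ : U →ₐ[ℂ] Module.End ℂ M) (σ : U →ₐ[ℂ] Module.End ℂ N) (u : U) (m : M)
    (n : N) : tensorRep ρ σ u (m ⊗ₜ n) =
      TensorProduct.map (ρ.toLinearMap.flip m) (σ.toLinearMap.flip n) (comul u) := by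
  change Module.endTensorEndAlgHom (R := ℂ) (S := ℂ) (A := ℂ)
    (TensorProduct.map ρ.toLinearMap σ.toLinearMap (comul u)) _ = _
  generalize (comul u : U ⊗[ℂ] U) = w
  induction w with
  | zero => simp
  | add x y hx hy => simp only [map_add, LinearMap.add_apply, hx, hy]
  | tmul x y => simp [Module.endTensorEndAlgHom_apply]

lemma IsRational.tensorRep {ρ : U →ₐ[ℂ] Module.End ℂ M} {σ : U →ₐ[ℂ] Module.End ℂ N}
    (hρ : IsRational C ρ) (hσ : IsRational C σ) : IsRational C (tensorRep ρ σ) := by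
  intro t
  induction t with
  | zero => simp
  | add x y hx hy =>
    rw [map_add]
    exact add_mem hx hy
  | tmul m n =>
    refine ⟨TensorProduct.map₂ (TensorProduct.mk ℂ M N) (LinearMap.mul ℂ _) (hρ.coaction m)
      (hσ.coaction n), LinearMap.ext fun u => ?_⟩
    rw [evalRight_map₂, TensorProduct.lift_mk, LinearMap.id_apply]
    refine Eq.trans ?_ (tensorRep_tmul ρ σ u m n).symm
    congr 2 <;> exact LinearMap.ext fun v => IsRational.evalRight_coaction _ _ v

end Rational

/-! ### Matrix coefficients and semisimplicity -/

section Coefficients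

variable {U : Type u} [Ring U] [HopfAlgebra ℂ U]
  {hS : Function.Bijective (HopfAlgebra.antipode ℂ (A := U))} {C : FinRep U → Prop}

lemma coeff_mul_coeff (hC : IsTensorCategory U hS C) (M N : FinRep U) (hM : C M) (hN : C N)
    (ξ : Dual ℂ M.V) (η : Dual ℂ N.V) (x : M.V) (y : N.V) :
    coeff M hM ξ x * coeff N hN η y = coeff (M.tensor N) (hC.tensor M N hM hN)
      (TensorProduct.dualDistrib ℂ M.V N.V (ξ ⊗ₜ η)) (x ⊗ₜ[ℂ] y : M.V ⊗[ℂ] N.V) := by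
  refine toDual_injective (LinearMap.ext fun u => ?_)
  rw [toDual_mul]
  have h : (M.tensor N).ρ u (x ⊗ₜ[ℂ] y : M.V ⊗[ℂ] N.V) =
    TensorProduct.map (M.ρ.toLinearMap.flip x) (N.ρ.toLinearMap.flip y) (comul u) :=
    tensorRep_tmul M.ρ N.ρ u x y
  refine Eq.trans ?_ (congrArg (TensorProduct.dualDistrib ℂ M.V N.V (ξ ⊗ₜ η)) h).symm
  generalize (comul u : U ⊗[ℂ] U) = w
  induction w with
  | zero => simp
  | add x y hx hy => simp only [map_add, hx, hy]
  | tmul p q => rfl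

/-- The algebra `U⁰_C` is spanned by the matrix coefficients. -/
lemma coeffAlg_add_induction (hC : IsTensorCategory U hS C) {Q : coeffAlg C → Prop}
    (h₁ : ∀ M hM ξ x, Q (coeff M hM ξ x)) (h₂ : ∀ a b, Q a → Q b → Q (a + b)) (a : coeffAlg C) :
    Q a := by
  have h0 : Q 0 := by
    have h : coeff (FinRep.trivial U) hC.trivial 0 0 = 0 :=
      toDual_injective (LinearMap.ext fun u => rfl)
    exact h ▸ h₁ (FinRep.trivial U) hC.trivial 0 0
  -- Sums of coefficients suffice: scalars are coefficients of the trivial module, and products are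
  -- coefficients of tensor products.
  suffices h : a ∈ AddSubmonoid.closure {a | ∃ M hM ξ x, a = coeff (C := C) M hM ξ x} by
    induction h using AddSubmonoid.closure_induction with
    | mem x hx =>
      obtain ⟨M, hM, ξ, x, rfl⟩ := hx
      exact h₁ M hM ξ x
    | zero => exact h0
    | add x y _ _ hx hy => exact h₂ x y hx hy
  induction a using coeffAlg_induction with
  | h₁ M hM ξ x => exact AddSubmonoid.subset_closure ⟨M, hM, ξ, x, rfl⟩
  | h₂ r =>
    refine AddSubmonoid.subset_closure ⟨FinRep.trivial U, hC.trivial,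
      r • (LinearMap.id : ℂ →ₗ[ℂ] ℂ), (1 : ℂ), ?_⟩
    refine toDual_injective (LinearMap.ext fun u => ?_)
    rw [Algebra.algebraMap_eq_smul_one, map_smul, LinearMap.smul_apply, toDual_one]
    change _ = r • (counit (R := ℂ) u * 1)
    rw [mul_one]
  | h₃ a b ha hb => exact add_mem ha hb
  | h₄ a b ha hb =>
    induction ha using AddSubmonoid.closure_induction with
    | zero => simp
    | add x y _ _ hx hy =>
      rw [add_mul]
      exact add_mem hx hy
    | mem x hx =>
      obtain ⟨M, hM, ξ, x, rfl⟩ := hx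
      induction hb using AddSubmonoid.closure_induction with
      | zero => simp
      | add x y _ _ hx hy =>
        rw [mul_add]
        exact add_mem hx hy
      | mem y hy =>
        obtain ⟨N, hN, η, y, rfl⟩ := hy
        exact AddSubmonoid.subset_closure ⟨_, _, _, _, coeff_mul_coeff hC M N hM hN ξ η x y⟩

/-- The algebra `U⁰_C` is closed under the transpose of the antipode. -/
lemma exists_antipode (hC : IsTensorCategory U hS C) :
    ∃ T : coeffAlg C →ₗ[ℂ] coeffAlg C,
      ∀ a u, toDual C (T a) u = toDual C a (HopfAlgebra.antipode ℂ u) := by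
  have h : ∀ a, ((HopfAlgebra.antipode ℂ (A := U)).dualMap ∘ₗ toDual C) a ∈
      LinearMap.range (toDual C) := by
    intro a
    induction a using coeffAlg_add_induction hC with
    | h₁ M hM ξ x =>
      -- By definition of the left dual, `u ↦ ξ(S(u)x)` is its coefficient at the vector `ξ` and the
      -- functional evaluation at `x`.
      exact ⟨coeff M.leftDual (hC.leftDual M hM) (Dual.eval ℂ M.V x) ξ, rfl⟩
    | h₂ a b ha hb =>
      rw [map_add]
      exact add_mem ha hb
  exact ⟨liftThrough (toDual C) toDual_injective _ h, fun a u =>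
    LinearMap.congr_fun (apply_liftThrough (toDual C) toDual_injective _ h a) u⟩

variable {M N P : Type*} [AddCommGroup M] [Module ℂ M] [AddCommGroup N] [Module ℂ N]
  [AddCommGroup P] [Module ℂ P]

/-- The `K`-module given by a representation of `U`. -/
abbrev resModule (K : LeftCoidealSubalgebra U) (ρ : U →ₐ[ℂ] Module.End ℂ M) :
    Module K.toSubalgebra M :=
  Module.compHom M (ρ.comp K.toSubalgebra.val).toRingHom

/-- Semisimplicity of a representation of `U` restricted to `K`. -/
def IsResSemisimple (K : LeftCoidealSubalgebra U) (ρ : U →ₐ[ℂ] Module.End ℂ M) : Prop :=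
  letI := resModule K ρ
  IsSemisimpleModule K.toSubalgebra M

variable {K : LeftCoidealSubalgebra U}

/-- For fixed `ξ` the map `x ↦ coeff M hM ξ x` is linear over `K`, so its image is semisimple as a
quotient of `M`. These images sum to `A`, and a sum of semisimple submodules is semisimple. -/
lemma isResSemisimple_regRep (hC : IsTensorCategory U hS C) (hK : IsCSemisimple C K) :
    IsResSemisimple K (regRep C) := by
  let _ := resModule K (regRep C)
  let p : {Q : Submodule K.toSubalgebra (coeffAlg C) // IsSemisimpleModule K.toSubalgebra Q} →
    Submodule K.toSubalgebra (coeffAlg C) := Subtype.val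
  refine isSemisimpleModule_of_isSemisimpleModule_submodule' (p := p) (fun i => i.2) ?_
  rw [eq_top_iff]
  intro a _
  induction a using coeffAlg_add_induction hC with
  | h₂ a b ha hb => exact add_mem (ha trivial) (hb trivial)
  | h₁ M hM ξ x =>
    let _ := resModule K M.ρ
    have hss : IsSemisimpleModule K.toSubalgebra M.V := hK M hM
    let φ : M.V →ₗ[K.toSubalgebra] coeffAlg C :=
      { toFun := coeff M hM ξ
        map_add' := fun x y => toDual_injective (LinearMap.ext fun u => by
          simp only [toDual_coeff, map_add, LinearMap.add_apply])
        map_smul' := fun k x => toDual_injective (LinearMap.ext fun u => by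
          refine Eq.trans ?_ (toDual_regRep k.1 _ u).symm
          rw [toDual_coeff, toDual_coeff, map_mul]
          rfl) }
    exact le_iSup p ⟨LinearMap.range φ, IsSemisimpleModule.range φ⟩ ⟨x, rfl⟩

/-- The coordinates of the coaction in a basis of `M` embed `M` into a direct sum of copies of `A`.
The embedding is injective because evaluating the coordinates at `1 ∈ U` returns the vector. -/
lemma IsRational.isResSemisimple {ρ : U →ₐ[ℂ] Module.End ℂ M} (h : IsRational C ρ)
    (hA : IsResSemisimple K (regRep C)) : IsResSemisimple K ρ := by
  classical
  let _ := resModule K (regRep C)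
  let _ := resModule K ρ
  have hA' : IsSemisimpleModule K.toSubalgebra (coeffAlg C) := hA
  obtain ⟨ι, ⟨b⟩⟩ : ∃ ι : Set M, Nonempty (Basis ι ℂ M) := ⟨_, ⟨Basis.ofVectorSpace ℂ M⟩⟩
  let θ : M →ₗ[ℂ] ι →₀ coeffAlg C :=
    (TensorProduct.equivFinsuppOfBasisLeft b).toLinearMap ∘ₗ h.coaction
  have hθ : ∀ m i v, toDual C (θ m i) v = b.coord i (ρ v m) := by
    intro m i v
    change toDual C (TensorProduct.equivFinsuppOfBasisLeft b (h.coaction m) i) v = _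
    rw [TensorProduct.equivFinsuppOfBasisLeft_apply, evalRight_lid, h.evalRight_coaction]
  let φ : M →ₗ[K.toSubalgebra] ι →₀ coeffAlg C :=
    { toFun := θ
      map_add' := map_add θ
      map_smul' := fun k m => by
        ext i
        refine toDual_injective (LinearMap.ext fun v => ?_)
        refine Eq.trans ?_ (toDual_regRep k.1 (θ m i) v).symm
        rw [hθ, hθ, map_mul]
        rfl }
  refine IsSemisimpleModule.of_injective φ fun m n hmn => b.ext_elem fun i => ?_
  have hm := hθ m i 1
  have hn := hθ n i 1
  rw [map_one ρ] at hm hn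
  refine hm.symm.trans (Eq.trans ?_ hn)
  exact congrArg (fun f : ι →₀ coeffAlg C => toDual C (f i) 1) hmn

lemma exists_equivariant_projection {ρ : U →ₐ[ℂ] Module.End ℂ M} (h : IsResSemisimple K ρ)
    (L : Submodule ℂ M) (hL : ∀ k ∈ K.toSubalgebra, ∀ x ∈ L, ρ k x ∈ L) :
    ∃ p : M →ₗ[ℂ] M, (∀ x, p x ∈ L) ∧ (∀ x ∈ L, p x = x) ∧
      ∀ k ∈ K.toSubalgebra, ∀ x, p (ρ k x) = ρ k (p x) := by
  let _ := resModule K ρ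
  have hss : IsSemisimpleModule K.toSubalgebra M := h
  let L' : Submodule K.toSubalgebra M :=
    { L with smul_mem' := fun k x hx => hL k.1 k.2 x hx }
  obtain ⟨q, hq⟩ := IsSemisimpleModule.extension_property L'.subtype L'.subtype_injective
    LinearMap.id
  -- The scalars of `ℂ` act through `ℂ1 ⊆ K`, so a `K`-linear map is automatically `ℂ`-linear.
  have hc : ∀ (c : ℂ) (x : M), algebraMap ℂ K.toSubalgebra c • x = c • x := fun c x => by
    change ρ (algebraMap ℂ U c) x = _
    simp
  refine ⟨{ toFun := fun x => (q x : M), map_add' := fun x y => by simp, map_smul' := fun c x => ?_ },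
    fun x => (q x).2, fun x hx => ?_, fun k hk x => ?_⟩
  · rw [← hc, map_smul, RingHom.id_apply, ← hc]
    rfl
  · exact congrArg Subtype.val (LinearMap.congr_fun hq ⟨x, hx⟩)
  · exact congrArg Subtype.val (q.map_smul (⟨k, hk⟩ : K.toSubalgebra) x)

/-- The surjection `L → f(L)` of `K`-modules splits because `L` is semisimple. The splitting is
extended to all of `P` only linearly, so that it can be applied to tensors; its properties are
asserted on `f(L)` alone. -/
lemma exists_equivariant_section {ρ : U →ₐ[ℂ] Module.End ℂ M} {σ : U →ₐ[ℂ] Module.End ℂ P}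
    (h : IsResSemisimple K ρ) (f : M →ₗ[ℂ] P)
    (hf : ∀ k ∈ K.toSubalgebra, ∀ x, f (ρ k x) = σ k (f x))
    (L : Submodule ℂ M) (hL : ∀ k ∈ K.toSubalgebra, ∀ x ∈ L, ρ k x ∈ L) :
    ∃ s : P →ₗ[ℂ] M, ∀ y ∈ L.map f, s y ∈ L ∧ f (s y) = y ∧
      ∀ k ∈ K.toSubalgebra, s (σ k y) = ρ k (s y) := by
  let _ := resModule K ρ
  let _ := resModule K σ
  have hss : IsSemisimpleModule K.toSubalgebra M := h
  let L' : Submodule K.toSubalgebra M :=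
    { L with smul_mem' := fun k x hx => hL k.1 k.2 x hx }
  let f' : M →ₗ[K.toSubalgebra] P :=
    { toFun := f
      map_add' := map_add f
      map_smul' := fun k x => hf k.1 k.2 x }
  let g : L' →ₗ[K.toSubalgebra] P := f' ∘ₗ L'.subtype
  obtain ⟨q, hq⟩ := IsSemisimpleModule.lifting_property g.rangeRestrict g.surjective_rangeRestrict
    LinearMap.id
  have hc : ∀ (c : ℂ) (x : M), algebraMap ℂ K.toSubalgebra c • x = c • x := fun c x => by
    change ρ (algebraMap ℂ U c) x = _
    simp
  have hc' : ∀ (c : ℂ) (x : P), algebraMap ℂ K.toSubalgebra c • x = c • x := fun c x => by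
    change σ (algebraMap ℂ U c) x = _
    simp
  have hg : ∀ y ∈ L.map f, y ∈ LinearMap.range g := by
    rintro _ ⟨x, hx, rfl⟩
    exact ⟨⟨x, hx⟩, rfl⟩
  let s₀ : L.map f →ₗ[ℂ] M :=
    { toFun := fun y => (q ⟨y, hg y y.2⟩ : M)
      map_add' := fun x y => congrArg Subtype.val (q.map_add ⟨x, hg x x.2⟩ ⟨y, hg y y.2⟩)
      map_smul' := fun c y => by
        rw [RingHom.id_apply, ← hc]
        refine Eq.trans ?_
          (congrArg Subtype.val (q.map_smul (algebraMap ℂ K.toSubalgebra c) ⟨y, hg y y.2⟩))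
        congr 2
        exact Subtype.ext (hc' c y).symm }
  obtain ⟨s, hs⟩ := s₀.exists_extend
  have hs' : ∀ y (hy : y ∈ L.map f), s y = q ⟨y, hg y hy⟩ := fun y hy =>
    LinearMap.congr_fun hs ⟨y, hy⟩
  refine ⟨s, fun y hy => ⟨?_, ?_, fun k hk => ?_⟩⟩
  · rw [hs' y hy]
    exact (q _).2
  · rw [hs' y hy]
    exact congrArg Subtype.val (LinearMap.congr_fun hq ⟨y, hg y hy⟩)
  · have hky : σ k y ∈ L.map f := by
      obtain ⟨x, hx, rfl⟩ := hy
      exact ⟨ρ k x, hL k hk x hx, hf k hk x⟩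
    rw [hs' y hy, hs' _ hky]
    exact congrArg Subtype.val (q.map_smul (⟨k, hk⟩ : K.toSubalgebra) ⟨y, hg y hy⟩)

end Coefficients

/-! ### Twisting rational representations -/

section RationalTwist

variable {U : Type u} [Ring U] [HopfAlgebra ℂ U]
  {hS : Function.Bijective (HopfAlgebra.antipode ℂ (A := U))} {C : FinRep U → Prop}
  {K : LeftCoidealSubalgebra U} {M : Type*} [AddCommGroup M] [Module ℂ M]

/-- On `m ⊗ a` the untwisted function is `u ↦ a(u₍₂₎) S(u₍₁₎)m`. Its coefficients are convolution
products of coefficients of `u ↦ S(u)m` with `a`, and the former lie in `A` because `A` is stable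
under the transpose of `S`. -/
lemma untwist_mem_range (hC : IsTensorCategory U hS C) {ρ : U →ₐ[ℂ] Module.End ℂ M}
    (h : IsRational C ρ) (t : M ⊗[ℂ] coeffAlg C) :
    untwist ρ (evalRight (toDual C) M t) ∈ LinearMap.range (evalRight (toDual C) M) := by
  obtain ⟨T, hT⟩ := exists_antipode hC
  induction t with
  | zero =>
    refine ⟨0, LinearMap.ext fun u => ?_⟩
    simp [untwist]
  | add x y hx hy =>
    have : untwist ρ (evalRight (toDual C) M (x + y)) =
        untwist ρ (evalRight (toDual C) M x) + untwist ρ (evalRight (toDual C) M y) := by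
      refine LinearMap.ext fun u => ?_
      simp [untwist, LinearMap.lTensor_add]
    rw [this]
    exact add_mem hx hy
  | tmul m a =>
    have hs : ∀ s : M ⊗[ℂ] coeffAlg C, ∀ u, evalRight (toDual C) M (T.lTensor M s) u =
        evalRight (toDual C) M s (HopfAlgebra.antipode ℂ u) := by
      intro s u
      induction s with
      | zero => simp
      | add x y hx hy => simp only [map_add, LinearMap.add_apply, hx, hy]
      | tmul m a => simp [hT]
    -- The first tensor represents `u ↦ S(u)m` and the second the scalar function `a`;
    -- `evalRight_map₂` evaluates their product along `Δ(u)`.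
    refine ⟨TensorProduct.map₂ (LinearMap.lsmul ℂ M).flip (LinearMap.mul ℂ _)
      (T.lTensor M (h.coaction m)) ((1 : ℂ) ⊗ₜ a), LinearMap.ext fun u => ?_⟩
    rw [evalRight_map₂, untwist, LinearMap.comp_apply, LinearMap.comp_apply]
    generalize (comul u : U ⊗[ℂ] U) = w
    induction w with
    | zero => simp
    | add x y hx hy => simp only [map_add, hx, hy]
    | tmul x y => simp [hs]

/-- The twist of a `K`-equivariant function on `U` with coefficients in `A` has coefficients
in `B`. -/
lemma exists_evalRight_eq_untwist (hC : IsTensorCategory U hS C) {ρ : U →ₐ[ℂ] Module.End ℂ M}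
    (h : IsRational C ρ) (t : M ⊗[ℂ] coeffAlg C)
    (ht : ∀ k ∈ K.toSubalgebra, ∀ u,
      evalRight (toDual C) M t (k * u) = ρ k (evalRight (toDual C) M t u)) :
    ∃ s : M ⊗[ℂ] invAlg C K,
      evalRight (invDual C K) M s = untwist ρ (evalRight (toDual C) M t) := by
  obtain ⟨s, hs⟩ := untwist_mem_range hC h t
  obtain ⟨s', rfl⟩ := mem_range_lTensor (invIncl C K).toLinearMap s fun φ => by
    refine ⟨⟨TensorProduct.lid ℂ _ (φ.rTensor _ s), (isInvariant_iff _).2 fun k hk u => ?_⟩, rfl⟩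
    rw [evalRight_lid, evalRight_lid, hs, untwist_mul_left K ρ _ ht k hk, map_smul, smul_eq_mul]
  exact ⟨s', by rw [← hs, evalRight_lTensor]⟩

end RationalTwist

/-! ### Hopf submodules of `B ⊗ B` -/

section EvalSnd

variable {B : Type*} [Ring B] [Algebra ℂ B]

/-- The map `a ⊗ b ↦ a χ(b)`. -/
def evalSnd (χ : B →ₐ[ℂ] ℂ) : B ⊗[ℂ] B →ₗ[ℂ] B :=
  TensorProduct.rid ℂ B ∘ₗ χ.toLinearMap.lTensor B

@[simp] lemma evalSnd_tmul (χ : B →ₐ[ℂ] ℂ) (a b : B) : evalSnd χ (a ⊗ₜ b) = χ b • a := by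
  simp [evalSnd]

/-- Right multiplication `(B ⊗ B) ⊗ B → B ⊗ B` on the second factor. -/
def mulSnd (B : Type*) [Ring B] [Algebra ℂ B] : (B ⊗[ℂ] B) ⊗[ℂ] B →ₗ[ℂ] B ⊗[ℂ] B :=
  (LinearMap.mul' ℂ B).lTensor B ∘ₗ (TensorProduct.assoc ℂ B B B).toLinearMap

@[simp] lemma mulSnd_tmul (a b c : B) : mulSnd B ((a ⊗ₜ b) ⊗ₜ c) = a ⊗ₜ (b * c) := rfl

lemma mulSnd_tmul_right (t : B ⊗[ℂ] B) (c : B) :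
    mulSnd B (t ⊗ₜ c) = (LinearMap.mulRight ℂ c).lTensor B t := by
  induction t with
  | zero => simp
  | add x y hx hy => rw [TensorProduct.add_tmul, map_add, map_add, hx, hy]
  | tmul a b => simp

end EvalSnd

section HopfSubmodules

variable {U : Type u} [Ring U] [HopfAlgebra ℂ U]
  {hS : Function.Bijective (HopfAlgebra.antipode ℂ (A := U))} {C : FinRep U → Prop}
  {K : LeftCoidealSubalgebra U}

variable (C K) in
/-- The diagonal representation of `U` on `B ⊗ B`. -/
def diagRep : U →ₐ[ℂ] Module.End ℂ (invAlg C K ⊗[ℂ] invAlg C K) :=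
  tensorRep (invReg C K) (invReg C K)

lemma diagRep_tmul (u : U) (a b : invAlg C K) : diagRep C K u (a ⊗ₜ b) =
    TensorProduct.map ((invReg C K).toLinearMap.flip a) ((invReg C K).toLinearMap.flip b)
      (comul u) :=
  tensorRep_tmul _ _ u a b

lemma isRational_diagRep : IsRational C (diagRep C K) :=
  (isRational_invReg K).tensorRep (isRational_invReg K)

/-- On `a ⊗ b` the left side is `ε(u₍₂₎b) u₍₁₎a`, and `ε(u₍₂₎b) = b(u₍₂₎)`. This is the bridge
between tensors and twisted functions on `U`. -/
lemma evalSnd_diagRep (u : U) (t : invAlg C K ⊗[ℂ] invAlg C K) :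
    evalSnd (invCounit C K) (diagRep C K u t) =
      twist (invReg C K) (evalRight (invDual C K) _ t) u := by
  rw [twist, LinearMap.comp_apply, LinearMap.comp_apply]
  induction t with
  | zero => simp
  | add x y hx hy => simp only [map_add, hx, hy, LinearMap.lTensor_add, LinearMap.add_apply]
  | tmul a b =>
    rw [diagRep_tmul]
    generalize (comul u : U ⊗[ℂ] U) = w
    induction w with
    | zero => simp
    | add x y hx hy => simp only [map_add, hx, hy]
    | tmul x y => simp [-LinearMap.coe_comp, invCounit_invReg]

/-- Twisting is injective by `untwist_twist`, and a tensor is determined by its evaluation since `B`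
embeds in the dual of `U`. -/
lemma eq_of_evalSnd_diagRep_eq {s t : invAlg C K ⊗[ℂ] invAlg C K}
    (h : ∀ u, evalSnd (invCounit C K) (diagRep C K u s) =
      evalSnd (invCounit C K) (diagRep C K u t)) : s = t := by
  refine evalRight_injective (toDual_invIncl_injective (C := C) (K := K)) ?_
  rw [← untwist_twist (invReg C K) (evalRight (invDual C K) _ s),
    ← untwist_twist (invReg C K) (evalRight (invDual C K) _ t)]
  congr 1
  ext1 u
  rw [← evalSnd_diagRep, h, evalSnd_diagRep]

/-- For `(a ⊗ b) ⊗ c` both sides are `b(u₍₂₎) c(u₍₃₎) u₍₁₎a`. In terms of twisted functions,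
multiplying the last two factors means applying `id ⊗ ε` to the values, which identifies the tensor
built in `le_of_map_evalSnd_le`. -/
lemma evalSnd_diagRep_mulSnd (u : U) (t : (invAlg C K ⊗[ℂ] invAlg C K) ⊗[ℂ] invAlg C K) :
    evalSnd (invCounit C K) (diagRep C K u (mulSnd _ t)) = evalSnd (invCounit C K)
      (twist (diagRep C K) (evalRight (invDual C K) _ t) u) := by
  induction t with
  | zero => simp [twist]
  | add x y hx hy =>
    simp only [map_add, LinearMap.add_apply, hx, hy, twist, LinearMap.comp_apply,
      LinearMap.lTensor_add]
  | tmul s c =>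
    induction s with
    | zero => simp [twist]
    | add x y hx hy =>
      simp only [map_add, TensorProduct.add_tmul, LinearMap.add_apply, hx, hy, twist,
        LinearMap.comp_apply, LinearMap.lTensor_add]
    | tmul a b =>
      -- `D` sends `x ⊗ y` to `b(x)c(y)a`, and `E` below sends it to `b(y) xa`. They group the three
      -- legs of the iterated coproduct from the right and from the left.
      let D : U ⊗[ℂ] U →ₗ[ℂ] invAlg C K := (LinearMap.toSpanSingleton ℂ _ a) ∘ₗ
        TensorProduct.dualDistrib ℂ U U (invDual C K b ⊗ₜ invDual C K c)
      have hL : evalSnd (invCounit C K) (diagRep C K u (mulSnd _ ((a ⊗ₜ b) ⊗ₜ c))) =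
          TensorProduct.lift (invReg C K).toLinearMap
            (D.lTensor U (comul.lTensor U (comul u))) := by
        rw [evalSnd_diagRep, mulSnd_tmul, twist, ← LinearMap.lTensor_comp_apply]
        rw [LinearMap.comp_apply, LinearMap.comp_apply]
        congr 2
      let E : U ⊗[ℂ] U →ₗ[ℂ] invAlg C K := TensorProduct.lift (invReg C K).toLinearMap ∘ₗ
        (evalRight (invDual C K) _ (a ⊗ₜ b)).lTensor U
      have hR : evalSnd (invCounit C K)
          (twist (diagRep C K) (evalRight (invDual C K) _ ((a ⊗ₜ b) ⊗ₜ c)) u) =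
          TensorProduct.rid ℂ _ (TensorProduct.map E (invDual C K c)
            (comul.rTensor U (comul u))) := by
        rw [twist, LinearMap.comp_apply, LinearMap.comp_apply]
        generalize (comul u : U ⊗[ℂ] U) = w
        induction w with
        | zero => simp
        | add x y hx hy => simp only [map_add, hx, hy]
        | tmul x y =>
          rw [LinearMap.lTensor_tmul, TensorProduct.lift.tmul, evalRight_tmul, map_smul, map_smul,
            AlgHom.toLinearMap_apply, evalSnd_diagRep]
          rfl
      have key : TensorProduct.lift (invReg C K).toLinearMap ∘ₗ D.lTensor U ∘ₗ
          (TensorProduct.assoc ℂ U U U).toLinearMap = (TensorProduct.rid ℂ _).toLinearMap ∘ₗ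
            TensorProduct.map E (invDual C K c) := by
        apply TensorProduct.ext_threefold
        intro x y z
        simp only [LinearMap.comp_apply, LinearEquiv.coe_coe, TensorProduct.assoc_tmul,
          LinearMap.lTensor_tmul, TensorProduct.lift.tmul, TensorProduct.map_tmul,
          TensorProduct.rid_tmul, D, E, TensorProduct.dualDistrib_apply,
          LinearMap.toSpanSingleton_apply, evalRight_tmul, map_smul, smul_smul, mul_comm]
      rw [hL, hR, ← coassoc_apply]
      exact LinearMap.congr_fun key _

/-- The coideal property puts the second leg of `Δ(k)` in `K`, and there `ε(yb) = ε(y)ε(b)` by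
invariance of `b`; the counit axiom then leaves `k` acting on the first factor. -/
lemma evalSnd_diagRep_of_mem (k : U) (hk : k ∈ K.toSubalgebra)
    (t : invAlg C K ⊗[ℂ] invAlg C K) : evalSnd (invCounit C K) (diagRep C K k t) =
      invReg C K k (evalSnd (invCounit C K) t) := by
  induction t with
  | zero => simp
  | add x y hx hy => simp only [map_add, hx, hy]
  | tmul a b =>
    rw [diagRep_tmul]
    have h : ∀ w ∈ LinearMap.range (K.toSubalgebra.toSubmodule.subtype.lTensor U),
        evalSnd (invCounit C K) (TensorProduct.map ((invReg C K).toLinearMap.flip a)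
          ((invReg C K).toLinearMap.flip b) w) =
        invReg C K (TensorProduct.rid ℂ U (counit.lTensor U w)) (invCounit C K b • a) := by
      rintro _ ⟨w, rfl⟩
      induction w with
      | zero => simp
      | add x y hx hy => simp only [map_add, hx, hy, LinearMap.add_apply]
      | tmul x y =>
        have := invDual_mul_left b y y.2 1
        rw [mul_one] at this
        simp only [LinearMap.lTensor_tmul, TensorProduct.map_tmul, evalSnd_tmul,
          Submodule.subtype_apply, LinearMap.flip_apply, AlgHom.toLinearMap_apply,
          invCounit_invReg, this, TensorProduct.rid_tmul, map_smul, LinearMap.smul_apply]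
        rw [invCounit_apply, smul_smul, mul_comm]
    rw [h _ (K.comul_mem k hk), lTensor_counit_comul, TensorProduct.rid_tmul, one_smul,
      evalSnd_tmul]

/-- A Hopf submodule of `B ⊗ B` contains every subcomodule with the same image under `id ⊗ ε`. -/
lemma le_of_map_evalSnd_le (hC : IsTensorCategory U hS C) (hK : IsCSemisimple C K)
    {N P : Submodule ℂ (invAlg C K ⊗[ℂ] invAlg C K)}
    (hN : ∀ u, ∀ t ∈ N, diagRep C K u t ∈ N)
    (hN' : ∀ c, ∀ t ∈ N, (LinearMap.mulRight ℂ c).lTensor _ t ∈ N)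
    (hP : ∀ u, ∀ t ∈ P, diagRep C K u t ∈ P)
    (h : P.map (evalSnd (invCounit C K)) ≤ N.map (evalSnd (invCounit C K))) : P ≤ N := by
  have hss : IsResSemisimple K (diagRep C K) :=
    isRational_diagRep.isResSemisimple (isResSemisimple_regRep hC hK)
  obtain ⟨s, hs⟩ := exists_equivariant_section (σ := invReg C K) hss (evalSnd (invCounit C K))
    (fun k hk x => evalSnd_diagRep_of_mem k hk x) N (fun k _ => hN k)
  intro t ht
  have hmem : ∀ u, evalSnd (invCounit C K) (diagRep C K u t) ∈ N.map (evalSnd (invCounit C K)) :=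
    fun u => h ⟨_, hP u t ht, rfl⟩
  set r := isRational_diagRep.coaction t with hr
  -- `q` represents `u ↦ s((id ⊗ ε)(ut))`, a `K`-equivariant function with values in `N` that lifts
  -- the function attached to `t`.
  set q := (s ∘ₗ evalSnd (invCounit C K)).rTensor (coeffAlg C) r with hq
  have hqu : ∀ u, evalRight (toDual C) _ q u = s (evalSnd (invCounit C K) (diagRep C K u t)) := by
    intro u
    rw [hq, evalRight_rTensor, hr, IsRational.evalRight_coaction, LinearMap.comp_apply]
  obtain ⟨p, hp⟩ := exists_evalRight_eq_untwist (K := K) hC isRational_diagRep q fun k hk u => by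
    rw [hqu, hqu, map_mul, Module.End.mul_apply, evalSnd_diagRep_of_mem k hk,
      (hs _ (hmem u)).2.2 k hk]
  -- Untwisting applies elements of `U` to values in `N`, so the values stay in `N` and `p` comes
  -- from `N ⊗ B`.
  have hpN : ∀ u, evalRight (invDual C K) _ p u ∈ N := by
    intro u
    rw [hp, untwist, LinearMap.comp_apply, LinearMap.comp_apply]
    generalize (comul u : U ⊗[ℂ] U) = w
    induction w with
    | zero => simp
    | add x y hx hy =>
      rw [map_add, map_add]
      exact add_mem hx hy
    | tmul x y =>
      rw [LinearMap.lTensor_tmul, hqu]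
      exact hN _ _ (hs _ (hmem y)).1
  have hpN' : mulSnd _ p ∈ N := by
    obtain ⟨p', hp'⟩ := mem_range_rTensor_subtype toDual_invIncl_injective N p hpN
    rw [← hp']
    clear hp'
    induction p' with
    | zero => simp
    | add x y hx hy =>
      rw [map_add, map_add]
      exact add_mem hx hy
    | tmul n b =>
      rw [LinearMap.rTensor_tmul, mulSnd_tmul_right]
      exact hN' b n n.2
  -- Twisting `p` returns `q`, and `id ⊗ ε` is a left inverse of `s` on the fibre, so `mulSnd p` and
  -- `t` have the same attached function and coincide.
  convert hpN' using 1
  refine eq_of_evalSnd_diagRep_eq fun u => ?_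
  rw [evalSnd_diagRep_mulSnd, hp, twist_untwist, hqu, (hs _ (hmem u)).2.1]

/-- The largest subcomodule of `B ⊗ B` mapped into `L` by `id ⊗ ε`. -/
def coind (L : Submodule ℂ (invAlg C K)) : Submodule ℂ (invAlg C K ⊗[ℂ] invAlg C K) :=
  ⨅ u : U, L.comap (evalSnd (invCounit C K) ∘ₗ diagRep C K u)

lemma mem_coind {L : Submodule ℂ (invAlg C K)} {t : invAlg C K ⊗[ℂ] invAlg C K} :
    t ∈ coind L ↔ ∀ u, evalSnd (invCounit C K) (diagRep C K u t) ∈ L := by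
  simp [coind]

/-- For `x ∈ L` and a `K`-equivariant projection `p` of `B` onto `L`, the function `u ↦ p(ux)` is
equivariant with values in `L`, and its value at `1` is `x`. Untwisting it gives an element of
`coind L` over `x`. -/
lemma map_evalSnd_coind (hC : IsTensorCategory U hS C) (hK : IsCSemisimple C K)
    {L : Submodule ℂ (invAlg C K)} (hL : ∀ k ∈ K.toSubalgebra, ∀ x ∈ L, invReg C K k x ∈ L) :
    (coind L).map (evalSnd (invCounit C K)) = L := by
  have hss : IsResSemisimple K (invReg C K) :=
    (isRational_invReg K).isResSemisimple (isResSemisimple_regRep hC hK)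
  obtain ⟨p, hpL, hp, hpK⟩ := exists_equivariant_projection hss L hL
  refine le_antisymm ?_ fun x hx => ?_
  · rintro _ ⟨t, ht, rfl⟩
    have := mem_coind.1 ht 1
    rwa [map_one] at this
  · set q := p.rTensor (coeffAlg C) (invCoaction C K x) with hq
    have hqu : ∀ u, evalRight (toDual C) _ q u = p (invReg C K u x) := by
      intro u
      rw [hq, evalRight_rTensor, evalRight_invCoaction]
    obtain ⟨t, ht⟩ := exists_evalRight_eq_untwist (K := K) hC (isRational_invReg K) q
      fun k hk u => by
        rw [hqu, hqu, map_mul, Module.End.mul_apply, hpK k hk]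
    have htu : ∀ u, evalSnd (invCounit C K) (diagRep C K u t) = p (invReg C K u x) := by
      intro u
      rw [evalSnd_diagRep, ht, twist_untwist, hqu]
    refine ⟨t, mem_coind.2 fun u => htu u ▸ hpL _, ?_⟩
    have := htu 1
    rwa [map_one, map_one, Module.End.one_apply, Module.End.one_apply, hp x hx] at this

end HopfSubmodules

namespace FODC

/-! ### Calculi and their relations -/

variable {B : Type u} [Ring B] [Algebra ℂ B]

/-- The map `B ⊗ B → Γ`, `a ⊗ b ↦ da b`. -/
def relMap (X : FODC B) : B ⊗[ℂ] B →ₗ[ℂ] X.Γ := TensorProduct.lift (X.ract.flip ∘ₗ X.d)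

@[simp] lemma relMap_tmul (X : FODC B) (a b : B) :
    X.relMap (a ⊗ₜ b) = MulOpposite.op b • X.d a := rfl

/-- The left multiplication `a (dx y) = d(ax) y - da xy` on `B ⊗ B`. -/
def mulLeftRel (B : Type u) [Ring B] [Algebra ℂ B] : B ⊗[ℂ] (B ⊗[ℂ] B) →ₗ[ℂ] B ⊗[ℂ] B :=
  (LinearMap.mul' ℂ B).rTensor B ∘ₗ (TensorProduct.assoc ℂ B B B).symm.toLinearMap -
    (LinearMap.mul' ℂ B).lTensor B

lemma mulLeftRel_tmul (a x y : B) :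
    mulLeftRel B (a ⊗ₜ (x ⊗ₜ y)) = (a * x) ⊗ₜ y - a ⊗ₜ (x * y) := rfl

lemma mulLeftRel_mul (a b : B) (t : B ⊗[ℂ] B) :
    mulLeftRel B ((a * b) ⊗ₜ t) = mulLeftRel B (a ⊗ₜ mulLeftRel B (b ⊗ₜ t)) := by
  induction t with
  | zero => simp
  | add x y hx hy => simp only [TensorProduct.tmul_add, map_add, hx, hy]
  | tmul x y =>
    simp only [mulLeftRel_tmul, TensorProduct.tmul_sub, map_sub, mul_assoc]
    abel

lemma mulLeftRel_one (t : B ⊗[ℂ] B) :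
    mulLeftRel B (1 ⊗ₜ t) = t - 1 ⊗ₜ LinearMap.mul' ℂ B t := by
  induction t with
  | zero => simp
  | add x y hx hy =>
    rw [TensorProduct.tmul_add, map_add, hx, hy, map_add, TensorProduct.tmul_add]
    abel
  | tmul x y => simp [mulLeftRel_tmul]

/-- After removal of the constant part, the left module structure of the calculus becomes ordinary
left multiplication; this makes `leftIdeal` a left ideal, whereas the fibre itself, which contains
`1`, need not be one. -/
lemma evalSnd_mulLeftRel (χ : B →ₐ[ℂ] ℂ) (a : B) (t : B ⊗[ℂ] B) :
    evalSnd χ (mulLeftRel B (a ⊗ₜ t)) =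
      a * (evalSnd χ t - algebraMap ℂ B (χ (evalSnd χ t))) := by
  induction t with
  | zero => simp
  | add x y hx hy =>
    simp only [TensorProduct.tmul_add, map_add, hx, hy]
    noncomm_ring
  | tmul x y =>
    simp [mulLeftRel_tmul, mul_sub, Algebra.algebraMap_eq_smul_one, mul_comm]

lemma evalSnd_mulSnd (χ : B →ₐ[ℂ] ℂ) (t : B ⊗[ℂ] B) (c : B) :
    evalSnd χ (mulSnd B (t ⊗ₜ c)) = χ c • evalSnd χ t := by
  induction t with
  | zero => simp
  | add x y hx hy => simp only [TensorProduct.add_tmul, map_add, hx, hy, smul_add]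
  | tmul x y => simp [smul_smul, mul_comm]

lemma relMap_mulSnd (X : FODC B) (t : B ⊗[ℂ] B) (c : B) :
    X.relMap (mulSnd B (t ⊗ₜ c)) = MulOpposite.op c • X.relMap t := by
  induction t with
  | zero => simp
  | add x y hx hy => simp only [TensorProduct.add_tmul, map_add, hx, hy, smul_add]
  | tmul x y => simp [mul_smul]

lemma relMap_mulLeftRel (X : FODC B) (a : B) (t : B ⊗[ℂ] B) :
    X.relMap (mulLeftRel B (a ⊗ₜ t)) = a • X.relMap t := by
  induction t with
  | zero => simp
  | add x y hx hy => simp only [TensorProduct.tmul_add, map_add, hx, hy, smul_add]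
  | tmul x y =>
    rw [mulLeftRel_tmul, map_sub, relMap_tmul, relMap_tmul, relMap_tmul, X.leibniz, smul_add,
      MulOpposite.op_mul, mul_smul, add_sub_cancel_right]
    exact (smul_comm a _ _).symm

lemma d_one (X : FODC B) : X.d 1 = 0 := by
  have h := X.leibniz 1 1
  rw [one_smul, MulOpposite.op_one, one_smul, mul_one] at h
  simpa using h

lemma one_tmul_mem_ker (X : FODC B) (b : B) : (1 : B) ⊗ₜ b ∈ LinearMap.ker X.relMap := by
  rw [LinearMap.mem_ker, relMap_tmul, d_one, smul_zero]

/-- The Leibniz rule rewrites `a db c` as `d(ab) c - da bc`. -/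
lemma relMap_surjective (X : FODC B) : Function.Surjective X.relMap := by
  rw [← LinearMap.range_eq_top, eq_top_iff, ← X.span_eq_top, Submodule.span_le]
  rintro _ ⟨a, b, c, rfl⟩
  refine ⟨mulSnd B (mulLeftRel B (a ⊗ₜ (b ⊗ₜ 1)) ⊗ₜ c), ?_⟩
  rw [relMap_mulSnd, relMap_mulLeftRel, relMap_tmul, MulOpposite.op_one, one_smul]

lemma d_eq_relMap (X : FODC B) (b : B) : X.d b = X.relMap (b ⊗ₜ 1) := by
  rw [relMap_tmul, MulOpposite.op_one, one_smul]

/-- Both module structures and the differential are induced from operations on `B ⊗ B` that do not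
depend on the calculus. -/
lemma iso_of_ker_eq {X Y : FODC B} (h : LinearMap.ker X.relMap = LinearMap.ker Y.relMap) :
    Iso X Y := by
  let e : X.Γ ≃ₗ[ℂ] Y.Γ :=
    (X.relMap.quotKerEquivOfSurjective X.relMap_surjective).symm ≪≫ₗ
      Submodule.quotEquivOfEq _ _ h ≪≫ₗ Y.relMap.quotKerEquivOfSurjective Y.relMap_surjective
  have he : ∀ t, e (X.relMap t) = Y.relMap t := by
    intro t
    have : (X.relMap.quotKerEquivOfSurjective X.relMap_surjective).symm (X.relMap t) =
        Submodule.Quotient.mk t := by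
      rw [LinearEquiv.symm_apply_eq]
      rfl
    simp only [e, LinearEquiv.trans_apply, this]
    rfl
  refine ⟨e, fun b ω => ?_, fun b ω => ?_, fun b => ?_⟩
  · obtain ⟨t, rfl⟩ := X.relMap_surjective ω
    rw [← relMap_mulLeftRel, he, he, relMap_mulLeftRel]
  · obtain ⟨t, rfl⟩ := X.relMap_surjective ω
    rw [← relMap_mulSnd, he, he, relMap_mulSnd]
  · rw [d_eq_relMap, d_eq_relMap, he]

lemma Iso.ker_eq {X Y : FODC B} (h : Iso X Y) :
    LinearMap.ker X.relMap = LinearMap.ker Y.relMap := by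
  obtain ⟨φ, -, h2, h3⟩ := h
  have : Y.relMap = φ.toLinearMap ∘ₗ X.relMap := by
    refine TensorProduct.ext' fun a b => ?_
    simp [h2, h3]
  rw [this, LinearMap.ker_comp, LinearEquiv.ker, Submodule.comap_bot]

/-! ### The left ideal of a calculus and dimensions -/

variable (χ : B →ₐ[ℂ] ℂ)

/-- The image of the relations `∑ da b = 0` under `id ⊗ ε`. -/
def relIdeal (X : FODC B) : Submodule ℂ B := (LinearMap.ker X.relMap).map (evalSnd χ)

lemma one_mem_relIdeal (X : FODC B) : 1 ∈ X.relIdeal χ :=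
  ⟨1 ⊗ₜ 1, X.one_tmul_mem_ker 1, by simp⟩

lemma leftIdeal_eq (X : FODC B) : X.leftIdeal χ =
    (X.relIdeal χ).map (LinearMap.id - Algebra.linearMap ℂ B ∘ₗ χ.toLinearMap) := by
  rw [relIdeal, ← Submodule.map_comp, leftIdeal]
  congr 1
  refine TensorProduct.ext' fun a b => ?_
  rw [LinearMap.comp_apply, LinearMap.comp_apply, evalSnd_tmul]
  simp [smul_sub]

lemma mem_leftIdeal {X : FODC B} {b : B} :
    b ∈ X.leftIdeal χ ↔ b ∈ X.relIdeal χ ∧ χ b = 0 := by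
  rw [leftIdeal_eq]
  constructor
  · rintro ⟨x, hx, rfl⟩
    refine ⟨sub_mem hx ?_, by simp⟩
    simp only [LinearMap.comp_apply, Algebra.linearMap_apply, Algebra.algebraMap_eq_smul_one]
    exact Submodule.smul_mem _ _ (X.one_mem_relIdeal χ)
  · rintro ⟨h1, h2⟩
    exact ⟨b, h1, by simp [h2]⟩

/-- The fibre is `leftIdeal ⊕ ℂ1`, so either of the two spaces determines the other. -/
lemma mem_relIdeal {X : FODC B} {b : B} :
    b ∈ X.relIdeal χ ↔ b - χ b • 1 ∈ X.leftIdeal χ := by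
  rw [mem_leftIdeal]
  have h1 : χ b • (1 : B) ∈ X.relIdeal χ := Submodule.smul_mem _ _ (X.one_mem_relIdeal χ)
  rw [(X.relIdeal χ).sub_mem_iff_left h1]
  simp

lemma mul_mem_leftIdeal {X : FODC B} {b : B} (hb : b ∈ X.leftIdeal χ) (a : B) :
    a * b ∈ X.leftIdeal χ := by
  obtain ⟨⟨t, ht, rfl⟩, h2⟩ := (mem_leftIdeal χ).1 hb
  refine (mem_leftIdeal χ).2 ⟨⟨mulLeftRel B (a ⊗ₜ t), ?_, ?_⟩, by rw [map_mul, h2, mul_zero]⟩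
  · rw [SetLike.mem_coe, LinearMap.mem_ker, relMap_mulLeftRel, LinearMap.mem_ker.1 ht, smul_zero]
  · rw [evalSnd_mulLeftRel, h2, map_zero, sub_zero]

/-- `ΓB⁺` is the image of the kernel of `id ⊗ ε`; hence `Γ / ΓB⁺` and `B` modulo the fibre are the
same quotient of `B ⊗ B`. -/
lemma relMap_mem_augSub_iff (X : FODC B) (t : B ⊗[ℂ] B) :
    X.relMap t ∈ X.augSub χ ↔ evalSnd χ t ∈ X.relIdeal χ := by
  have h1 : X.augSub χ ≤ (LinearMap.ker (evalSnd χ)).map X.relMap := by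
    refine Submodule.span_le.2 ?_
    rintro _ ⟨ω, b, hb, rfl⟩
    obtain ⟨s, rfl⟩ := X.relMap_surjective ω
    refine ⟨mulSnd B (s ⊗ₜ b), ?_, X.relMap_mulSnd s b⟩
    rw [SetLike.mem_coe, LinearMap.mem_ker, evalSnd_mulSnd, hb, zero_smul]
  -- Modulo `ΓB⁺` one has `da b = ε(b) da`.
  have h2 : ∀ s, X.relMap s - X.relMap (evalSnd χ s ⊗ₜ 1) ∈ X.augSub χ := by
    intro s
    induction s with
    | zero => simp
    | add x y hx hy =>
      have := add_mem hx hy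
      rw [map_add, map_add, TensorProduct.add_tmul, map_add]
      convert this using 1
      abel
    | tmul a b =>
      refine Submodule.subset_span ⟨X.d a, b - algebraMap ℂ B (χ b), by simp, ?_⟩
      rw [evalSnd_tmul, relMap_tmul, relMap_tmul, MulOpposite.op_one, one_smul, MulOpposite.op_sub,
        sub_smul, map_smul, Algebra.algebraMap_eq_smul_one, MulOpposite.op_smul, smul_assoc,
        MulOpposite.op_one, one_smul]
  constructor
  · intro h
    obtain ⟨s, hs, hst⟩ := h1 h
    refine ⟨t - s, ?_, ?_⟩
    · rw [SetLike.mem_coe, LinearMap.mem_ker, map_sub, hst, sub_self]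
    · rw [map_sub, LinearMap.mem_ker.1 hs, sub_zero]
  · rintro ⟨s, hs, hst⟩
    have := sub_mem (h2 t) (h2 s)
    rw [hst, LinearMap.mem_ker.1 hs] at this
    simpa using this

/-- `Γ / ΓB⁺` in terms of `B`. -/
def quotAugSubEquiv (X : FODC B) : (X.Γ ⧸ X.augSub χ) ≃ₗ[ℂ] B ⧸ X.relIdeal χ := by
  let f : B ⊗[ℂ] B →ₗ[ℂ] X.Γ ⧸ X.augSub χ := (X.augSub χ).mkQ ∘ₗ X.relMap
  let g : B ⊗[ℂ] B →ₗ[ℂ] B ⧸ X.relIdeal χ := (X.relIdeal χ).mkQ ∘ₗ evalSnd χ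
  have hf : Function.Surjective f := (Submodule.mkQ_surjective _).comp X.relMap_surjective
  have hg : Function.Surjective g :=
    (Submodule.mkQ_surjective _).comp fun b => ⟨b ⊗ₜ 1, by simp⟩
  have h : LinearMap.ker f = LinearMap.ker g := by
    ext t
    simpa [f, g] using X.relMap_mem_augSub_iff χ t
  exact (f.quotKerEquivOfSurjective hf).symm ≪≫ₗ Submodule.quotEquivOfEq _ _ h ≪≫ₗ
    g.quotKerEquivOfSurjective hg

/-- `B / L` is one dimension larger than `Γ / ΓB⁺`. -/
def quotLeftIdealEquiv (X : FODC B) : (B ⧸ X.leftIdeal χ) ≃ₗ[ℂ] (B ⧸ X.relIdeal χ) × ℂ := by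
  let f : B →ₗ[ℂ] (B ⧸ X.relIdeal χ) × ℂ := (X.relIdeal χ).mkQ.prod χ.toLinearMap
  have hf : Function.Surjective f := by
    rintro ⟨b, c⟩
    obtain ⟨b, rfl⟩ := (X.relIdeal χ).mkQ_surjective b
    refine ⟨b + (c - χ b) • 1, Prod.ext ?_ (by simp [f])⟩
    have : (X.relIdeal χ).mkQ 1 = 0 :=
      (Submodule.Quotient.mk_eq_zero _).2 (X.one_mem_relIdeal χ)
    change (X.relIdeal χ).mkQ _ = _
    rw [map_add, map_smul, this, smul_zero, add_zero]
  have h : X.leftIdeal χ = LinearMap.ker f := by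
    ext b
    simp [f, mem_leftIdeal]
  exact Submodule.quotEquivOfEq _ _ h ≪≫ₗ f.quotKerEquivOfSurjective hf

/-- The annihilator of `leftIdeal` is the dual of `(Γ / ΓB⁺) × ℂ`; the extra dimension comes from
the counit. -/
lemma hasDim_iff (X : FODC B) (n : ℕ) :
    X.HasDim χ n ↔ Module.finrank ℂ (X.tangentEps χ) = n + 1 := by
  have e : Dual ℂ ((B ⧸ X.relIdeal χ) × ℂ) ≃ₗ[ℂ] X.tangentEps χ :=
    (X.quotLeftIdealEquiv χ).dualMap ≪≫ₗ (X.leftIdeal χ).dualQuotEquivDualAnnihilator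
  rw [HasDim, (X.quotAugSubEquiv χ).rank_eq, ← e.finrank_eq]
  constructor
  · intro h
    have : Module.Finite ℂ (B ⧸ X.relIdeal χ) := Module.finite_of_rank_eq_nat h
    rw [Subspace.dual_finrank_eq, Module.finrank_prod, Module.finrank_self,
      Module.finrank_eq_of_rank_eq h]
  · intro h
    -- `finrank` vanishes on infinite-dimensional spaces, so the value `n + 1 > 0` forces finite
    -- dimension, also for `n = 0`.
    have h1 : FiniteDimensional ℂ (Dual ℂ ((B ⧸ X.relIdeal χ) × ℂ)) :=
      FiniteDimensional.of_finrank_pos (by omega)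
    have h2 : FiniteDimensional ℂ ((B ⧸ X.relIdeal χ) × ℂ) :=
      (Module.finite_dual_iff ℂ).1 h1
    have h3 : FiniteDimensional ℂ (B ⧸ X.relIdeal χ) :=
      Module.Finite.of_surjective (LinearMap.fst ℂ _ ℂ) LinearMap.fst_surjective
    rw [Subspace.dual_finrank_eq, Module.finrank_prod, Module.finrank_self] at h
    rw [← Module.finrank_eq_rank, Nat.add_right_cancel h]

/-! ### Construction of calculi -/

/-- The conditions on a subspace `N` of `B ⊗ B` to be the kernel of `a ⊗ b ↦ da b` for a
calculus. -/
structure IsRelations (N : Submodule ℂ (B ⊗[ℂ] B)) : Prop where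
  one_tmul : ∀ b : B, 1 ⊗ₜ b ∈ N
  mulSnd : ∀ (c : B), ∀ t ∈ N, mulSnd B (t ⊗ₜ c) ∈ N
  mulLeftRel : ∀ (a : B), ∀ t ∈ N, mulLeftRel B (a ⊗ₜ t) ∈ N

variable {N : Submodule ℂ (B ⊗[ℂ] B)}

/-- The left action on `(B ⊗ B) / N`. -/
def IsRelations.left (h : IsRelations N) : B →ₐ[ℂ] Module.End ℂ ((B ⊗[ℂ] B) ⧸ N) :=
  AlgHom.ofLinearMap
    { toFun := fun a => N.mapQ N (FODC.mulLeftRel B ∘ₗ TensorProduct.mk ℂ B _ a)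
        fun t ht => h.mulLeftRel a t ht
      map_add' := fun a b => by
        refine Submodule.linearMap_qext _ (LinearMap.ext fun t => ?_)
        exact congrArg N.mkQ (by simp [TensorProduct.add_tmul] : FODC.mulLeftRel B ((a + b) ⊗ₜ t) =
          FODC.mulLeftRel B (a ⊗ₜ t) + FODC.mulLeftRel B (b ⊗ₜ t))
      map_smul' := fun c a => by
        refine Submodule.linearMap_qext _ (LinearMap.ext fun t => ?_)
        exact congrArg N.mkQ (by rw [← TensorProduct.smul_tmul', map_smul] :
          FODC.mulLeftRel B ((c • a) ⊗ₜ t) = c • FODC.mulLeftRel B (a ⊗ₜ t)) }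
    (by
      refine Submodule.linearMap_qext _ (LinearMap.ext fun t => ?_)
      refine (Submodule.Quotient.eq N).2 ?_
      -- The unit law holds only modulo `N`: the difference is `-(1 ⊗ μ(t))` with `μ` the product of
      -- `B`, which lies in `N` because `d1 = 0` is imposed.
      change FODC.mulLeftRel B (1 ⊗ₜ t) - t ∈ N
      rw [mulLeftRel_one, sub_sub_cancel_left]
      exact neg_mem (h.one_tmul _))
    (fun a b => by
      refine Submodule.linearMap_qext _ (LinearMap.ext fun t => ?_)
      exact congrArg N.mkQ (mulLeftRel_mul a b t))

/-- The right action on `(B ⊗ B) / N`. -/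
def IsRelations.right (h : IsRelations N) : Bᵐᵒᵖ →ₐ[ℂ] Module.End ℂ ((B ⊗[ℂ] B) ⧸ N) :=
  AlgHom.ofLinearMap
    { toFun := fun a => N.mapQ N (QTangent.mulSnd B ∘ₗ (TensorProduct.mk ℂ _ B).flip a.unop)
        fun t ht => h.mulSnd a.unop t ht
      map_add' := fun a b => by
        refine Submodule.linearMap_qext _ (LinearMap.ext fun t => ?_)
        exact congrArg N.mkQ (by simp [TensorProduct.tmul_add] :
          QTangent.mulSnd B (t ⊗ₜ (a + b).unop) =
            QTangent.mulSnd B (t ⊗ₜ a.unop) + QTangent.mulSnd B (t ⊗ₜ b.unop))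
      map_smul' := fun c a => by
        refine Submodule.linearMap_qext _ (LinearMap.ext fun t => ?_)
        exact congrArg N.mkQ (by simp :
          QTangent.mulSnd B (t ⊗ₜ (c • a).unop) = c • QTangent.mulSnd B (t ⊗ₜ a.unop)) }
    (by
      refine Submodule.linearMap_qext _ (TensorProduct.ext' fun x y => ?_)
      exact congrArg N.mkQ (congrArg (x ⊗ₜ ·) (mul_one y)))
    (fun a b => by
      refine Submodule.linearMap_qext _ (TensorProduct.ext' fun x y => ?_)
      exact congrArg N.mkQ (congrArg (x ⊗ₜ ·) (mul_assoc y _ _).symm))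

/-- The calculus with given relations. -/
def ofRelations (h : IsRelations N) : FODC B :=
  letI := Module.compHom ((B ⊗[ℂ] B) ⧸ N) h.left.toRingHom
  letI := Module.compHom ((B ⊗[ℂ] B) ⧸ N) h.right.toRingHom
  have hl : ∀ (a : B) (t : B ⊗[ℂ] B), a • N.mkQ t = N.mkQ (FODC.mulLeftRel B (a ⊗ₜ t)) :=
    fun _ _ => rfl
  have hr : ∀ (a : B) (t : B ⊗[ℂ] B),
      MulOpposite.op a • N.mkQ t = N.mkQ (QTangent.mulSnd B (t ⊗ₜ a)) := fun _ _ => rfl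
  { Γ := (B ⊗[ℂ] B) ⧸ N
    leftTower := ⟨fun c a ω => LinearMap.congr_fun (map_smul h.left c a) ω⟩
    rightTower := ⟨fun c a ω => LinearMap.congr_fun (map_smul h.right c a) ω⟩
    bimodule := ⟨fun a b ω => by
      obtain ⟨t, rfl⟩ := N.mkQ_surjective ω
      induction b using MulOpposite.rec' with | _ b
      rw [hl, hr, hr, hl]
      congr 1
      induction t with
      | zero => simp
      | add x y hx hy => simp only [TensorProduct.add_tmul, TensorProduct.tmul_add, map_add, hx, hy]
      | tmul x y =>
        simp only [mulSnd_tmul, mulLeftRel_tmul, TensorProduct.sub_tmul, map_sub, mul_assoc]⟩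
    d := N.mkQ ∘ₗ (TensorProduct.mk ℂ B B).flip 1
    leibniz := fun a b => by
      simp only [LinearMap.comp_apply, LinearMap.flip_apply, TensorProduct.mk_apply]
      rw [hl, hr, ← map_add, mulLeftRel_tmul, mulSnd_tmul, mul_one, one_mul, sub_add_cancel]
    span_eq_top := by
      rw [eq_top_iff]
      rintro ω -
      obtain ⟨t, rfl⟩ := N.mkQ_surjective ω
      induction t with
      | zero => simp
      | add x y hx hy =>
        rw [map_add]
        exact add_mem hx hy
      | tmul x y =>
        refine Submodule.subset_span ⟨1, x, y, ?_⟩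
        rw [one_smul]
        refine Eq.trans ?_ (hr y (x ⊗ₜ 1)).symm
        rw [mulSnd_tmul, one_mul] }

lemma ker_relMap_ofRelations (h : IsRelations N) : LinearMap.ker (ofRelations h).relMap = N := by
  have : (ofRelations h).relMap = N.mkQ := by
    refine TensorProduct.ext' fun x y => ?_
    exact congrArg N.mkQ (by rw [mulSnd_tmul, one_mul] :
      QTangent.mulSnd B ((x ⊗ₜ 1) ⊗ₜ y) = x ⊗ₜ y)
  rw [this]
  exact N.ker_mkQ

end FODC

/-! ### Equivariance of the structure maps of `B ⊗ B` -/

section Equivariance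

variable {U : Type u} [Ring U] [HopfAlgebra ℂ U]
  {M N P : Type*} [AddCommGroup M] [Module ℂ M] [AddCommGroup N] [Module ℂ N]
  [AddCommGroup P] [Module ℂ P]

lemma assoc_tensorRep (ρ : U →ₐ[ℂ] Module.End ℂ M) (σ : U →ₐ[ℂ] Module.End ℂ N)
    (τ : U →ₐ[ℂ] Module.End ℂ P) (u : U) (t : (M ⊗[ℂ] N) ⊗[ℂ] P) :
    TensorProduct.assoc ℂ M N P (tensorRep (tensorRep ρ σ) τ u t) =
      tensorRep ρ (tensorRep σ τ) u (TensorProduct.assoc ℂ M N P t) := by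
  induction t with
  | zero => simp
  | add x y hx hy => simp only [map_add, hx, hy]
  | tmul s p =>
    induction s with
    | zero => simp
    | add x y hx hy => simp only [TensorProduct.add_tmul, map_add, hx, hy]
    | tmul m n =>
      rw [TensorProduct.assoc_tmul, tensorRep_tmul, tensorRep_tmul]
      have h1 : (tensorRep ρ σ).toLinearMap.flip (m ⊗ₜ n) =
          TensorProduct.map (ρ.toLinearMap.flip m) (σ.toLinearMap.flip n) ∘ₗ comul :=
        LinearMap.ext fun v => tensorRep_tmul ρ σ v m n
      have h2 : (tensorRep σ τ).toLinearMap.flip (n ⊗ₜ p) =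
          TensorProduct.map (σ.toLinearMap.flip n) (τ.toLinearMap.flip p) ∘ₗ comul :=
        LinearMap.ext fun v => tensorRep_tmul σ τ v n p
      rw [h1, h2, ← LinearMap.map_comp_rTensor, ← LinearMap.map_comp_lTensor, LinearMap.comp_apply,
        LinearMap.comp_apply, ← coassoc_apply]
      generalize (comul.rTensor U (comul u) : (U ⊗[ℂ] U) ⊗[ℂ] U) = w
      exact LinearMap.congr_fun (TensorProduct.ext_threefold fun x y z => rfl :
        (TensorProduct.assoc ℂ M N P).toLinearMap ∘ₗ
          TensorProduct.map (TensorProduct.map (ρ.toLinearMap.flip m) (σ.toLinearMap.flip n))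
            (τ.toLinearMap.flip p) =
        TensorProduct.map (ρ.toLinearMap.flip m)
          (TensorProduct.map (σ.toLinearMap.flip n) (τ.toLinearMap.flip p)) ∘ₗ
            (TensorProduct.assoc ℂ U U U).toLinearMap) w

lemma lTensor_tensorRep {ρ : U →ₐ[ℂ] Module.End ℂ M} {σ : U →ₐ[ℂ] Module.End ℂ N}
    (τ : U →ₐ[ℂ] Module.End ℂ P) {f : M →ₗ[ℂ] N} (hf : ∀ u x, f (ρ u x) = σ u (f x)) (u : U)
    (t : P ⊗[ℂ] M) : f.lTensor P (tensorRep τ ρ u t) = tensorRep τ σ u (f.lTensor P t) := by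
  induction t with
  | zero => simp
  | add x y hx hy => simp only [map_add, hx, hy]
  | tmul p m =>
    rw [LinearMap.lTensor_tmul, tensorRep_tmul, tensorRep_tmul]
    generalize (comul u : U ⊗[ℂ] U) = w
    induction w with
    | zero => simp
    | add x y hx hy => simp only [map_add, hx, hy]
    | tmul x y => simp [hf]

lemma rTensor_tensorRep {ρ : U →ₐ[ℂ] Module.End ℂ M} {σ : U →ₐ[ℂ] Module.End ℂ N}
    (τ : U →ₐ[ℂ] Module.End ℂ P) {f : M →ₗ[ℂ] N} (hf : ∀ u x, f (ρ u x) = σ u (f x)) (u : U)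
    (t : M ⊗[ℂ] P) : f.rTensor P (tensorRep ρ τ u t) = tensorRep σ τ u (f.rTensor P t) := by
  induction t with
  | zero => simp
  | add x y hx hy => simp only [map_add, hx, hy]
  | tmul m p =>
    rw [LinearMap.rTensor_tmul, tensorRep_tmul, tensorRep_tmul]
    generalize (comul u : U ⊗[ℂ] U) = w
    induction w with
    | zero => simp
    | add x y hx hy => simp only [map_add, hx, hy]
    | tmul x y => simp [hf]

variable {C : FinRep U → Prop} {K : LeftCoidealSubalgebra U}

lemma mul'_diagRep (u : U) (t : invAlg C K ⊗[ℂ] invAlg C K) :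
    LinearMap.mul' ℂ _ (diagRep C K u t) = invReg C K u (LinearMap.mul' ℂ _ t) := by
  induction t with
  | zero => simp
  | add x y hx hy => simp only [map_add, hx, hy]
  | tmul a b => rw [diagRep_tmul, LinearMap.mul'_apply, invReg_mul]

lemma mulSnd_tensorRep (u : U) (t : (invAlg C K ⊗[ℂ] invAlg C K) ⊗[ℂ] invAlg C K) :
    mulSnd _ (tensorRep (diagRep C K) (invReg C K) u t) = diagRep C K u (mulSnd _ t) := by
  rw [mulSnd, LinearMap.comp_apply, LinearMap.comp_apply]
  exact (congrArg _ (assoc_tensorRep (invReg C K) (invReg C K) (invReg C K) u t)).trans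
    (lTensor_tensorRep (ρ := diagRep C K) (invReg C K) mul'_diagRep u _)

/-- The twisted left multiplication is built from the product of `B` and associators, and the
product is equivariant by `invReg_mul`. -/
lemma mulLeftRel_tensorRep (u : U) (t : invAlg C K ⊗[ℂ] (invAlg C K ⊗[ℂ] invAlg C K)) :
    FODC.mulLeftRel _ (tensorRep (invReg C K) (diagRep C K) u t) =
      diagRep C K u (FODC.mulLeftRel _ t) := by
  have h : (TensorProduct.assoc ℂ _ _ _).symm (tensorRep (invReg C K) (diagRep C K) u t) =
      tensorRep (diagRep C K) (invReg C K) u ((TensorProduct.assoc ℂ _ _ _).symm t) := by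
    rw [LinearEquiv.symm_apply_eq]
    refine Eq.trans ?_ (assoc_tensorRep (invReg C K) (invReg C K) (invReg C K) u _).symm
    rw [LinearEquiv.apply_symm_apply]
    rfl
  rw [FODC.mulLeftRel, LinearMap.sub_apply, LinearMap.sub_apply, map_sub, LinearMap.comp_apply,
    LinearMap.comp_apply, LinearEquiv.coe_coe, h]
  exact congrArg₂ _ (rTensor_tensorRep (ρ := diagRep C K) (invReg C K) mul'_diagRep u _)
    (lTensor_tensorRep (ρ := diagRep C K) (invReg C K) mul'_diagRep u _)

end Equivariance

/-! ### Covariance -/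

section Covariance

variable {U : Type u} [Ring U] [HopfAlgebra ℂ U] {C : FinRep U → Prop}
  {M N P : Type*} [AddCommGroup M] [Module ℂ M] [AddCommGroup N] [Module ℂ N]
  [AddCommGroup P] [Module ℂ P]

lemma evalRight_lTensor_comul (s : M ⊗[ℂ] coeffAlg C) (u v : U) :
    evalRight (ev₂ C) M (comul.lTensor M s) (u ⊗ₜ v) = evalRight (toDual C) M s (u * v) := by
  induction s with
  | zero => simp
  | add x y hx hy => simp only [map_add, LinearMap.add_apply, hx, hy]
  | tmul m a =>
    rw [LinearMap.lTensor_tmul, evalRight_tmul, evalRight_tmul]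
    exact congrArg (· • m) (ev₂_coeffComul a u v)

lemma evalRight_assoc_rTensor (Φ : M →ₗ[ℂ] N ⊗[ℂ] coeffAlg C) (s : M ⊗[ℂ] coeffAlg C) (u v : U) :
    evalRight (ev₂ C) N (TensorProduct.assoc ℂ N _ _ (Φ.rTensor _ s)) (u ⊗ₜ v) =
      evalRight (toDual C) N (Φ (evalRight (toDual C) M s v)) u := by
  induction s with
  | zero => simp
  | add x y hx hy => simp only [map_add, LinearMap.add_apply, hx, hy]
  | tmul m a =>
    rw [LinearMap.rTensor_tmul, evalRight_tmul, map_smul, map_smul, LinearMap.smul_apply]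
    generalize Φ m = r
    induction r with
    | zero => simp
    | add x y hx hy => simp only [TensorProduct.add_tmul, map_add, LinearMap.add_apply, hx, hy,
        smul_add]
    | tmul n b => simp [smul_smul, mul_comm]

lemma rid_lTensor_counit (s : M ⊗[ℂ] coeffAlg C) :
    TensorProduct.rid ℂ M (counit.lTensor M s) = evalRight (toDual C) M s 1 := by
  induction s with
  | zero => simp
  | add x y hx hy => simp only [map_add, LinearMap.add_apply, hx, hy]
  | tmul m a =>
    rw [LinearMap.lTensor_tmul, TensorProduct.rid_tmul, evalRight_tmul]
    rfl

lemma map₂_flip_mul {A : Type*} [Ring A] [Algebra ℂ A] (f : M →ₗ[ℂ] N →ₗ[ℂ] P) (s : M ⊗[ℂ] A)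
    (t : N ⊗[ℂ] A) : TensorProduct.map₂ f (LinearMap.mul ℂ A).flip s t =
      TensorProduct.map₂ f.flip (LinearMap.mul ℂ A) t s := by
  induction s with
  | zero => simp
  | add x y hx hy => simp only [map_add, LinearMap.add_apply, hx, hy]
  | tmul m a =>
    induction t with
    | zero => simp
    | add x y hx hy => simp only [map_add, LinearMap.add_apply, hx, hy]
    | tmul n b => rfl

variable {K : LeftCoidealSubalgebra U}

namespace FODC

/-- Compatibility of `Φ` with `d` and with right multiplication forces its evaluation at `u` to be
the map on `Γ` induced by the diagonal action; since that map is well defined on `Γ`, the kernel is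
stable. -/
lemma IsCovariant.diagRep_mem_ker {X : FODC (invAlg C K)} (h : X.IsCovariant (invCoaction C K))
    (u : U) {t : invAlg C K ⊗[ℂ] invAlg C K} (ht : t ∈ LinearMap.ker X.relMap) :
    diagRep C K u t ∈ LinearMap.ker X.relMap := by
  obtain ⟨Φ, -, -, -, h4, h5⟩ := h
  have key : ∀ t, evalRight (toDual C) X.Γ (Φ (X.relMap t)) u = X.relMap (diagRep C K u t) := by
    intro t
    induction t with
    | zero => simp
    | add x y hx hy => simp only [map_add, LinearMap.add_apply, hx, hy]
    | tmul a b =>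
      rw [relMap_tmul, h4, map₂_flip_mul, evalRight_map₂, h5, diagRep_tmul]
      generalize (comul u : U ⊗[ℂ] U) = w
      induction w with
      | zero => simp
      | add x y hx hy => simp only [map_add, hx, hy]
      | tmul x y =>
        rw [TensorProduct.map_tmul, TensorProduct.map_tmul, TensorProduct.lift.tmul,
          evalRight_rTensor, evalRight_invCoaction, evalRight_invCoaction]
        rfl
  rw [LinearMap.mem_ker, ← key, LinearMap.mem_ker.1 ht, map_zero, map_zero, LinearMap.zero_apply]

/-- The coaction of `B ⊗ B` descends to the quotient `Γ`. As elements of `A` are functionals on `U`,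
every axiom can be checked by evaluation at elements of `U`, where it becomes equivariance of the
structure maps. -/
lemma isCovariant_of_diagRep_mem_ker {X : FODC (invAlg C K)}
    (h : ∀ u, ∀ t ∈ LinearMap.ker X.relMap, diagRep C K u t ∈ LinearMap.ker X.relMap) :
    X.IsCovariant (invCoaction C K) := by
  let Ψ : invAlg C K ⊗[ℂ] invAlg C K →ₗ[ℂ] X.Γ ⊗[ℂ] coeffAlg C :=
    X.relMap.rTensor _ ∘ₗ isRational_diagRep.coaction
  have hΨ : ∀ t u, evalRight (toDual C) X.Γ (Ψ t) u = X.relMap (diagRep C K u t) := fun t u => by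
    rw [LinearMap.comp_apply, evalRight_rTensor, IsRational.evalRight_coaction]
  have hker : LinearMap.ker X.relMap ≤ LinearMap.ker Ψ := fun t ht =>
    evalRight_ext toDual_injective fun u => by
      rw [hΨ, LinearMap.mem_ker.1 (h u t ht), map_zero, LinearMap.zero_apply]
  let Φ : X.Γ →ₗ[ℂ] X.Γ ⊗[ℂ] coeffAlg C := (LinearMap.ker X.relMap).liftQ Ψ hker ∘ₗ
    (X.relMap.quotKerEquivOfSurjective X.relMap_surjective).symm.toLinearMap
  have hΦ : ∀ t u, evalRight (toDual C) X.Γ (Φ (X.relMap t)) u = X.relMap (diagRep C K u t) := by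
    intro t u
    have : (X.relMap.quotKerEquivOfSurjective X.relMap_surjective).symm (X.relMap t) =
        Submodule.Quotient.mk t := by
      rw [LinearEquiv.symm_apply_eq]
      rfl
    rw [← hΨ, LinearMap.comp_apply, LinearEquiv.coe_coe, this]
    rfl
  clear_value Φ
  refine ⟨Φ, fun ω => ?_, fun ω => ?_, fun b ω => ?_, fun b ω => ?_, fun b => ?_⟩
  · obtain ⟨t, rfl⟩ := X.relMap_surjective ω
    refine evalRight_injective (ev₂_injective (C := C)) (TensorProduct.ext' fun u v => ?_)
    rw [evalRight_assoc_rTensor, evalRight_lTensor_comul, hΦ, hΦ, hΦ, map_mul,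
      Module.End.mul_apply]
  · obtain ⟨t, rfl⟩ := X.relMap_surjective ω
    rw [rid_lTensor_counit, hΦ, map_one, Module.End.one_apply]
  · obtain ⟨t, rfl⟩ := X.relMap_surjective ω
    refine evalRight_ext toDual_injective fun u => ?_
    rw [← relMap_mulLeftRel, hΦ, evalRight_map₂, ← mulLeftRel_tensorRep, tensorRep_tmul]
    generalize (comul u : U ⊗[ℂ] U) = w
    induction w with
    | zero => simp
    | add x y hx hy => simp only [map_add, hx, hy]
    | tmul x y =>
      rw [TensorProduct.map_tmul, TensorProduct.map_tmul, TensorProduct.lift.tmul,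
        relMap_mulLeftRel, hΦ, evalRight_invCoaction]
      rfl
  · obtain ⟨t, rfl⟩ := X.relMap_surjective ω
    refine evalRight_ext toDual_injective fun u => ?_
    rw [← relMap_mulSnd, hΦ, map₂_flip_mul, evalRight_map₂, ← mulSnd_tensorRep, tensorRep_tmul]
    generalize (comul u : U ⊗[ℂ] U) = w
    induction w with
    | zero => simp
    | add x y hx hy => simp only [map_add, hx, hy]
    | tmul x y =>
      rw [TensorProduct.map_tmul, TensorProduct.map_tmul, TensorProduct.lift.tmul,
        relMap_mulSnd, hΦ, evalRight_invCoaction]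
      rfl
  · refine evalRight_ext toDual_injective fun u => ?_
    rw [d_eq_relMap, hΦ, evalRight_rTensor, evalRight_invCoaction, d_eq_relMap, diagRep_tmul]
    have h1 : (invReg C K).toLinearMap.flip 1 = LinearMap.toSpanSingleton ℂ _ 1 ∘ₗ counit :=
      LinearMap.ext fun v => invReg_one v
    rw [h1, ← LinearMap.map_comp_lTensor, LinearMap.comp_apply, lTensor_counit_comul,
      TensorProduct.map_tmul, LinearMap.toSpanSingleton_apply, one_smul]
    rfl

/-! ### The correspondence -/

lemma relIdeal_invReg_mem {X : FODC (invAlg C K)} (h : X.IsCovariant (invCoaction C K))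
    {k : U} (hk : k ∈ K.toSubalgebra) {b : invAlg C K} (hb : b ∈ X.relIdeal (invCounit C K)) :
    invReg C K k b ∈ X.relIdeal (invCounit C K) := by
  obtain ⟨t, ht, rfl⟩ := hb
  exact ⟨_, h.diagRep_mem_ker k ht, evalSnd_diagRep_of_mem k hk t⟩

lemma leftIdeal_invReg_mem {X : FODC (invAlg C K)} (h : X.IsCovariant (invCoaction C K))
    {k : U} (hk : k ∈ K.toSubalgebra) {b : invAlg C K} (hb : b ∈ X.leftIdeal (invCounit C K)) :
    invReg C K k b ∈ X.leftIdeal (invCounit C K) := by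
  rw [mem_leftIdeal] at hb ⊢
  refine ⟨relIdeal_invReg_mem h hk hb.1, ?_⟩
  rw [invCounit_invReg, ← mul_one k, invDual_mul_left b k hk, ← invCounit_apply, hb.2, mul_zero]

end FODC

end Covariance

/-! ### Left ideals of finite codimension and the dual coalgebra -/

section FiniteDual

variable {R : Type*} [Ring R] [Algebra ℂ R]

/-- The functionals vanishing on a left ideal of finite codimension belong to `R°`. -/
lemma dualAnnihilator_le_finDual (L : Submodule ℂ R) (hL : ∀ a, ∀ b ∈ L, a * b ∈ L)
    [FiniteDimensional ℂ (R ⧸ L)] : L.dualAnnihilator ≤ finDual R := by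
  intro f hf
  -- The kernel of the action of `R` on `R / L` is a two-sided ideal of finite codimension. It is
  -- contained in `L`, as seen by acting on the class of `1`.
  let φ : R →ₗ[ℂ] Module.End ℂ (R ⧸ L) :=
    { toFun := fun a => L.mapQ L (LinearMap.mulLeft ℂ a) fun b hb => hL a b hb
      map_add' := fun a b => Submodule.linearMap_qext _ (LinearMap.ext fun c =>
        congrArg L.mkQ (add_mul a b c))
      map_smul' := fun r a => Submodule.linearMap_qext _ (LinearMap.ext fun c =>
        congrArg L.mkQ (smul_mul_assoc r a c)) }
  have hφ : ∀ a, a ∈ LinearMap.ker φ ↔ ∀ b, a * b ∈ L := by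
    intro a
    rw [LinearMap.mem_ker]
    constructor
    · intro h b
      exact (Submodule.Quotient.mk_eq_zero L).1 (LinearMap.congr_fun h (L.mkQ b))
    · intro h
      exact Submodule.linearMap_qext _ (LinearMap.ext fun b =>
        (Submodule.Quotient.mk_eq_zero L).2 (h b))
  refine ⟨LinearMap.ker φ, fun a x hx => ?_, Module.Finite.equiv φ.quotKerEquivRange.symm,
    fun x hx => ?_⟩
  · rw [hφ] at hx
    refine ⟨(hφ _).2 fun b => ?_, (hφ _).2 fun b => ?_⟩
    · rw [mul_assoc]
      exact hL a _ (hx b)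
    · rw [mul_assoc]
      exact hx _
  · have := (hφ x).1 hx 1
    rw [mul_one] at this
    exact (Submodule.mem_dualAnnihilator f).1 hf x this

/-- A subspace `T` of `R°` satisfies `ΔT ⊆ R° ⊗ T` if it contains the left translates of its
elements. -/
lemma finDualComul_mem_range (T : Submodule ℂ (finDual R)) {f : finDual R}
    (h : ∀ a, ∃ g ∈ T, ∀ b, g.1 b = f.1 (a * b)) :
    finDualComul f ∈ LinearMap.range (T.subtype.lTensor (finDual R)) := by
  have hF := finDual_comul_mem f
  -- The slices `f(· w)` lie in `R°` because `Δf ∈ R° ⊗ R°`, and the slices `f(a ·)` lie in `T` by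
  -- hypothesis.
  obtain ⟨s, hs⟩ := mem_range_evTensor (Y := T) (i := (finDual R).subtype)
    (j := (finDual R).subtype ∘ₗ T.subtype) _ (finite_range_of_mem_range_evTensor hF)
    (fun w => by
      obtain ⟨t, ht⟩ := hF
      rw [← ht]
      clear ht
      induction t with
      | zero =>
        refine ⟨0, LinearMap.ext fun x => ?_⟩
        simp
      | add x y hx hy =>
        obtain ⟨x', hx⟩ := hx
        obtain ⟨y', hy⟩ := hy
        refine ⟨x' + y', ?_⟩
        rw [map_add, hx, hy]
        refine LinearMap.ext fun z => ?_
        simp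
      | tmul x y =>
        refine ⟨y.1 w • x, LinearMap.ext fun z => ?_⟩
        simp [mul_comm])
    (fun a => by
      obtain ⟨g, hg, hga⟩ := h a
      refine ⟨⟨g, hg⟩, LinearMap.ext fun b => ?_⟩
      exact hga b)
  refine ⟨s, evTensor_injective (finDual R).subtype_injective (finDual R).subtype_injective ?_⟩
  refine Eq.trans ?_ (hs.trans (LinearMap.ext fun z => ?_))
  · clear hs
    induction s with
    | zero => simp
    | add x y hx hy => simp only [map_add, hx, hy]
    | tmul x y => rfl
  · exact (LinearMap.congr_fun (apply_liftThrough _ (evTensor_injective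
      (finDual R).subtype_injective (finDual R).subtype_injective) _ finDual_comul_mem f) z).symm

lemma apply_mul_eq_zero_of_finDualComul_mem {T : Submodule ℂ (finDual R)} {f : finDual R}
    (h : finDualComul f ∈ LinearMap.range (T.subtype.lTensor (finDual R))) (a : R) {b : R}
    (hb : ∀ g ∈ T, g.1 b = 0) : f.1 (a * b) = 0 := by
  obtain ⟨s, hs⟩ := h
  rw [← finDualComul_apply, ← hs]
  clear hs
  induction s with
  | zero => simp
  | add x y hx hy => simp only [map_add, LinearMap.add_apply, hx, hy, add_zero]
  | tmul x y =>
    rw [LinearMap.lTensor_tmul, evTensor_tmul]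
    exact mul_eq_zero_of_right _ (hb y y.2)

end FiniteDual

/-! ### From calculi to tangent spaces and back -/

section Correspondence

variable {U : Type u} [Ring U] [HopfAlgebra ℂ U] {C : FinRep U → Prop}
  {K : LeftCoidealSubalgebra U} {n : ℕ}

lemma tangentEps_le_finDual (X : CovFODC C K n) :
    X.1.tangentEps (invCounit C K) ≤ finDual (invAlg C K) := by
  have h1 : FiniteDimensional ℂ (X.1.leftIdeal (invCounit C K)).dualAnnihilator :=
    FiniteDimensional.of_finrank_pos ((X.1.hasDim_iff _ n).1 X.2.2 ▸ n.succ_pos)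
  have h2 : FiniteDimensional ℂ (Dual ℂ (invAlg C K ⧸ X.1.leftIdeal (invCounit C K))) :=
    Module.Finite.equiv
      (Submodule.dualQuotEquivDualAnnihilator (X.1.leftIdeal (invCounit C K))).symm
  have h3 := (Module.finite_dual_iff ℂ).1 h2
  exact dualAnnihilator_le_finDual _ fun a b hb => FODC.mul_mem_leftIdeal _ hb a

/-- The subspace `T^ε` of `B°` defined by a covariant calculus. -/
def tangentSpace (X : CovFODC C K n) : Submodule ℂ (finDual (invAlg C K)) :=
  (X.1.tangentEps (invCounit C K)).comap (finDual (invAlg C K)).subtype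

lemma map_tangentSpace (X : CovFODC C K n) :
    (tangentSpace X).map (finDual (invAlg C K)).subtype = X.1.tangentEps (invCounit C K) := by
  rw [tangentSpace, Submodule.map_comap_subtype, inf_eq_right]
  exact tangentEps_le_finDual X

lemma mem_tangentSpace {X : CovFODC C K n} {f : finDual (invAlg C K)} :
    f ∈ tangentSpace X ↔ ∀ b ∈ X.1.leftIdeal (invCounit C K), f.1 b = 0 :=
  Submodule.mem_dualAnnihilator f.1

/-- Each condition is dual to a property of `leftIdeal`: it lies in `ker ε`, it is a left ideal, and
it is stable under `K`. -/
lemma isTangentSpace_tangentSpace (X : CovFODC C K n) : IsTangentSpace n (tangentSpace X) where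
  dim := by
    rw [← (X.1.hasDim_iff _ n).1 X.2.2, ← map_tangentSpace, Submodule.finrank_map_subtype_eq]
  counit_mem := mem_tangentSpace.2 fun b hb => ((FODC.mem_leftIdeal _).1 hb).2
  comul_mem f hf := finDualComul_mem_range _ fun a => by
    have hmem : f.1 ∘ₗ LinearMap.mulLeft ℂ a ∈ X.1.tangentEps (invCounit C K) :=
      (Submodule.mem_dualAnnihilator _).2 fun b hb =>
        mem_tangentSpace.1 hf _ (FODC.mul_mem_leftIdeal _ hb a)
    exact ⟨⟨_, tangentEps_le_finDual X hmem⟩, hmem, fun b => rfl⟩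
  act_mem f hf k hk := by
    have hmem : dualAct f.1 k ∈ X.1.tangentEps (invCounit C K) :=
      (Submodule.mem_dualAnnihilator _).2 fun b hb => by
        rw [dualAct_apply]
        exact mem_tangentSpace.1 hf _ (FODC.leftIdeal_invReg_mem X.2.1 hk hb)
    exact ⟨⟨_, tangentEps_le_finDual X hmem⟩, hmem, rfl⟩

lemma tangentSpace_eq_of_iso {X Y : CovFODC C K n} (h : FODC.Iso X.1 Y.1) :
    tangentSpace X = tangentSpace Y := by
  rw [tangentSpace, tangentSpace, FODC.tangentEps, FODC.tangentEps, FODC.leftIdeal_eq,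
    FODC.leftIdeal_eq, FODC.relIdeal, FODC.relIdeal, h.ker_eq]

variable {hS : Function.Bijective (HopfAlgebra.antipode ℂ (A := U))}

/-- Over a field the annihilator determines `leftIdeal`, hence the fibre, and by
`le_of_map_evalSnd_le` applied in both directions the fibre determines the relations. -/
lemma iso_of_tangentSpace_eq (hC : IsTensorCategory U hS C) (hK : IsCSemisimple C K)
    {X Y : CovFODC C K n} (h : tangentSpace X = tangentSpace Y) : FODC.Iso X.1 Y.1 := by
  have h1 : X.1.tangentEps (invCounit C K) = Y.1.tangentEps (invCounit C K) := by
    rw [← map_tangentSpace, ← map_tangentSpace, h]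
  have h2 : X.1.leftIdeal (invCounit C K) = Y.1.leftIdeal (invCounit C K) :=
    Subspace.dualAnnihilator_inj.1 h1
  have h3 : X.1.relIdeal (invCounit C K) = Y.1.relIdeal (invCounit C K) := by
    ext b
    rw [FODC.mem_relIdeal, FODC.mem_relIdeal, h2]
  have key : ∀ X Y : CovFODC C K n,
      X.1.relIdeal (invCounit C K) ≤ Y.1.relIdeal (invCounit C K) →
      LinearMap.ker X.1.relMap ≤ LinearMap.ker Y.1.relMap := fun X Y h =>
    le_of_map_evalSnd_le hC hK (fun u t ht => Y.2.1.diagRep_mem_ker u ht)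
      (fun c t ht => by
        rw [← mulSnd_tmul_right, LinearMap.mem_ker, FODC.relMap_mulSnd, LinearMap.mem_ker.1 ht,
          smul_zero])
      (fun u t ht => X.2.1.diagRep_mem_ker u ht) h
  exact FODC.iso_of_ker_eq (le_antisymm (key X Y h3.le) (key Y X h3.ge))

/-- Each operation on `B ⊗ B` is equivariant, so it suffices to follow it under `id ⊗ ε`. Condition
`h2` concerns only the augmented part of `b`, since `L` contains `1`. -/
lemma isRelations_coind {L : Submodule ℂ (invAlg C K)} (h1 : 1 ∈ L)
    (h2 : ∀ a, ∀ b ∈ L, a * (b - algebraMap ℂ _ (invCounit C K b)) ∈ L) :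
    FODC.IsRelations (coind L) where
  one_tmul b := mem_coind.2 fun u => by
    have h : (invReg C K).toLinearMap.flip 1 = LinearMap.toSpanSingleton ℂ _ 1 ∘ₗ counit :=
      LinearMap.ext fun v => invReg_one v
    rw [diagRep_tmul, h, ← LinearMap.map_comp_rTensor, LinearMap.comp_apply, rTensor_counit_comul,
      TensorProduct.map_tmul, LinearMap.toSpanSingleton_apply, one_smul, evalSnd_tmul]
    exact L.smul_mem _ h1
  mulSnd c t ht := mem_coind.2 fun u => by
    rw [← mulSnd_tensorRep, tensorRep_tmul]
    generalize (comul u : U ⊗[ℂ] U) = w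
    induction w with
    | zero => simp
    | add x y hx hy =>
      rw [map_add, map_add, map_add]
      exact add_mem hx hy
    | tmul x y =>
      rw [TensorProduct.map_tmul, FODC.evalSnd_mulSnd]
      exact L.smul_mem _ (mem_coind.1 ht x)
  mulLeftRel a t ht := mem_coind.2 fun u => by
    rw [← mulLeftRel_tensorRep, tensorRep_tmul]
    generalize (comul u : U ⊗[ℂ] U) = w
    induction w with
    | zero => simp
    | add x y hx hy =>
      rw [map_add, map_add, map_add]
      exact add_mem hx hy
    | tmul x y =>
      rw [TensorProduct.map_tmul, FODC.evalSnd_mulLeftRel]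
      exact h2 _ _ (mem_coind.1 ht y)

lemma diagRep_mem_coind {L : Submodule ℂ (invAlg C K)} (u : U)
    {t : invAlg C K ⊗[ℂ] invAlg C K} (ht : t ∈ coind L) : diagRep C K u t ∈ coind L :=
  mem_coind.2 fun v => by
    rw [← Module.End.mul_apply, ← map_mul]
    exact mem_coind.1 ht _

lemma exists_tangentSpace_eq (hC : IsTensorCategory U hS C) (hK : IsCSemisimple C K)
    {T : Submodule ℂ (finDual (invAlg C K))} (hT : IsTangentSpace n T) :
    ∃ X : CovFODC C K n, tangentSpace X = T := by
  set W := T.map (finDual (invAlg C K)).subtype with hW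
  have hWdim : Module.finrank ℂ W = n + 1 := by
    rw [hW, Submodule.finrank_map_subtype_eq, hT.dim]
  have hWfin : FiniteDimensional ℂ W := FiniteDimensional.of_finrank_pos (by omega)
  -- `J` is the common zero set of `T`; it will be the left ideal of the calculus to be constructed.
  set J := W.dualCoannihilator with hJ
  have hmemJ : ∀ {b}, b ∈ J ↔ ∀ g ∈ T, g.1 b = 0 := by
    intro b
    rw [hJ, Submodule.mem_dualCoannihilator, hW]
    simp [Submodule.mem_map]
  have hε : ∀ b ∈ J, invCounit C K b = 0 := fun b hb => hmemJ.1 hb _ hT.counit_mem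
  have hmul : ∀ a, ∀ b ∈ J, a * b ∈ J := fun a b hb => hmemJ.2 fun f hf =>
    apply_mul_eq_zero_of_finDualComul_mem (hT.comul_mem f hf) a (hmemJ.1 hb)
  have hact : ∀ k ∈ K.toSubalgebra, ∀ b ∈ J, invReg C K k b ∈ J := fun k hk b hb =>
    hmemJ.2 fun f hf => by
      obtain ⟨g, hg, hgf⟩ := hT.act_mem f hf k hk
      rw [← dualAct_apply, ← hgf]
      exact hmemJ.1 hb g hg
  let p : invAlg C K →ₗ[ℂ] invAlg C K :=
    LinearMap.id - Algebra.linearMap ℂ _ ∘ₗ (invCounit C K).toLinearMap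
  have hp : ∀ b, p b = b - algebraMap ℂ _ (invCounit C K b) := fun b => rfl
  -- Since `J ⊆ ker ε`, this is `J ⊕ ℂ1`, the prospective fibre of the relations.
  let L : Submodule ℂ (invAlg C K) := J.comap p
  have hJL : J ≤ L := fun b hb => by
    rw [Submodule.mem_comap, hp, hε b hb, map_zero, sub_zero]
    exact hb
  have hL1 : (1 : invAlg C K) ∈ L := by
    rw [Submodule.mem_comap, hp, map_one, map_one, sub_self]
    exact zero_mem _
  have hLK : ∀ k ∈ K.toSubalgebra, ∀ x ∈ L, invReg C K k x ∈ L := by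
    intro k hk x hx
    rw [Submodule.mem_comap, hp] at hx ⊢
    convert hact k hk _ hx using 1
    rw [map_sub, Algebra.algebraMap_eq_smul_one, Algebra.algebraMap_eq_smul_one, map_smul,
      invReg_one, invCounit_invReg, ← mul_one k, invDual_mul_left x k hk, mul_one, smul_smul,
      invCounit_apply, mul_comm]
  have hrel := isRelations_coind hL1 fun a b hb => hJL (hmul a _ hb)
  let X := FODC.ofRelations hrel
  have hXker : LinearMap.ker X.relMap = coind L := FODC.ker_relMap_ofRelations hrel
  have hXrel : X.relIdeal (invCounit C K) = L := by
    rw [FODC.relIdeal, hXker, map_evalSnd_coind hC hK hLK]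
  have hXL : X.leftIdeal (invCounit C K) = J := by
    ext b
    rw [FODC.mem_leftIdeal, hXrel]
    constructor
    · rintro ⟨h1, h2⟩
      rwa [Submodule.mem_comap, hp, h2, map_zero, sub_zero] at h1
    · exact fun hb => ⟨hJL hb, hε b hb⟩
  have hXT : X.tangentEps (invCounit C K) = W := by
    -- The double annihilator returns `W` because `W` is finite-dimensional.
    rw [FODC.tangentEps, hXL, hJ, Subspace.dualCoannihilator_dualAnnihilator_eq]
  refine ⟨⟨X, FODC.isCovariant_of_diagRep_mem_ker fun u t ht => ?_, ?_⟩, ?_⟩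
  · rw [hXker] at ht ⊢
    exact diagRep_mem_coind u ht
  · rw [FODC.hasDim_iff, hXT, hWdim]
  · change (X.tangentEps (invCounit C K)).comap _ = T
    rw [hXT, hW]
    exact Submodule.comap_map_eq_of_injective (finDual (invAlg C K)).subtype_injective T

end Correspondence

end QTangent

end

theorem mainTheorem2 {U : Type u} [Ring U] [HopfAlgebra ℂ U]
    (hS : Function.Bijective (HopfAlgebra.antipode ℂ (A := U)))
    (C : QTangent.FinRep U → Prop) (hC : QTangent.IsTensorCategory U hS C)
    (hsep : ∀ u : U, (∀ a : QTangent.coeffAlg C, QTangent.pairing C u a = 0) → u = 0)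
    (K : QTangent.LeftCoidealSubalgebra U) (hK : QTangent.IsCSemisimple C K) (n : ℕ) :
    ∃ e : Quotient (QTangent.covFODCSetoid C K n) ≃
        {T : Submodule ℂ (QTangent.finDual (QTangent.invAlg C K)) // QTangent.IsTangentSpace n T},
      ∀ X : QTangent.CovFODC C K n,
        (e ⟦X⟧).1.map (QTangent.finDual (QTangent.invAlg C K)).subtype =
          X.1.tangentEps (QTangent.invCounit C K) := by
  let F : Quotient (QTangent.covFODCSetoid C K n) →
      {T : Submodule ℂ (QTangent.finDual (QTangent.invAlg C K)) // QTangent.IsTangentSpace n T} :=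
    Quotient.lift (fun X => ⟨QTangent.tangentSpace X, QTangent.isTangentSpace_tangentSpace X⟩)
      fun X Y h => Subtype.ext (QTangent.tangentSpace_eq_of_iso h)
  have hF : Function.Bijective F := by
    constructor
    · intro x y
      induction x using Quotient.inductionOn with | _ X
      induction y using Quotient.inductionOn with | _ Y
      intro h
      exact Quotient.sound (QTangent.iso_of_tangentSpace_eq hC hK (congrArg Subtype.val h))
    · rintro ⟨T, hT⟩
      obtain ⟨X, hX⟩ := QTangent.exists_tangentSpace_eq hC hK hT
      exact ⟨⟦X⟧, Subtype.ext hX⟩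
  exact ⟨Equiv.ofBijective F hF, fun X => QTangent.map_tangentSpace X⟩
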